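/- **Setting.** There are $M\ge 1$ agents and $K\ge 1$ arms. In round $t=1,2,\dots$, arm $k$ yields agent $i$ a reward $r^i_k(t)$ whose distribution $\nu_k$ is the same for all agents (a single cluster) and all rounds; $\nu_k$ has mean $\mu_k$ and is $\sigma^2$-sub-Gaussian, i.e. $\mathbb E\,e^{\lambda(X-\mu_k)}\le e^{\sigma^2\lambda^2/2}$ for $X\sim\nu_k$ and all $\lambda\in\mathbb R$. At the end of round $t$, a random undirected graph $G_t$ on the agents is drawn in which each pair of distinct agents is adjacent with probability $p\in(0,1]$. All rewards and all edge indicators, over all rounds, are mutually independent. Let $k^*$ be an optimal arm, $\mu_{k^*}=\max_k\mu_k$, and $\Delta_k=\mu_{k^*}-\mu_k$. With $n_{i,k}(T)$ the number of pulls of arm $k$ by agent $i$ in rounds $1,\dots,T$, the regret is $R_T=\frac1M\sum_{k=1}^K\sum_{i=1}^M\Delta_k\,n_{i,k}(T)$. **Algorithm (cooperative UCB with exploration constant $c$).** In rounds $1,\dots,K$ every agent pulls the $K$ arms one by one. In every round $t>K$, agent $m$ pulls an arm $k$ maximizing $$u^{m}_{k,t}=\hat\mu^{m}_{k}+\sqrt{\frac{c\log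 t}{\tilde N^{m}_{k}}},$$ where $\tilde N^{m}_{k}$ is the number of observations of arm $k$ known to agent $m$ after round $t-1$, namely its own, plus, for every other agent $m'$, those made by $m'$ itself up to and including the last round $\le t-1$ in which $m$ and $m'$ were adjacent (none if there was no such round); $\hat\mu^{m}_{k}$ is the average of these observations. Ties are broken by an arbitrary deterministic rule. **Theorem 1.** Let $\sigma^2\ge 0$, $c>2\sigma^2$ and $D\in\mathbb R$. There is a constant $C$, depending only on $\sigma^2$, $c$ and $D$, such that for all $M,K\ge1$, all $p\in(0,1]$, all reward distributions $\nu_1,\dots,\nu_K$ as above with $\Delta_k\le D$ for all $k$, and all $T\ge1$, $$\mathbb E[R_T]\le C\left(\sum_{k:\,\Delta_k>0}\frac{\log T}{M\Delta_k}+\frac{K}{p^{M^2}}\right).$$ In particular, for $c=1$, i.e. for the index $\hat\mu^m_k+\sqrt{\log t/\tilde N^m_k}$, this holds whenever $\sigma^2<1/2$, for instance for rewards in $[0,1]$. -/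

import Mathlib

open MeasureTheory ProbabilityTheory Finset
open scoped NNReal

namespace CoopBandit

/-! ## Statistics of a run

Rounds are numbered `1, 2, 3, …`.  A run is described by
* `a : ℕ → Fin M → Fin K`, where `a s i` is the arm pulled by agent `i` in round `s`;
* `r : ℕ → Fin M → Fin K → ℝ`, where `r s i k` is the reward that arm `k` yields to agent `i` in
  round `s` (it is observed only if `a s i = k`);
* `G : ℕ → SimpleGraph (Fin M)`, where `G s` is the communication graph of round `s`, used at the
  end of the round, after the pulls of round `s`. -/

variable {M K : ℕ}

/-- `n_{i,k}(t)`: the number of pulls of arm `k` by agent `i` in rounds `1, …, t`. -/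
def pulls (a : ℕ → Fin M → Fin K) (i : Fin M) (k : Fin K) (t : ℕ) : ℕ :=
  #{s ∈ Finset.Icc 1 t | a s i = k}

/-- The sum of the rewards that agent `i` received from arm `k` in rounds `1, …, t`. -/
def rewardSum (a : ℕ → Fin M → Fin K) (r : ℕ → Fin M → Fin K → ℝ)
    (i : Fin M) (k : Fin K) (t : ℕ) : ℝ :=
  ∑ s ∈ Finset.Icc 1 t with a s i = k, r s i k

open Classical in
/-- The latest round `s ∈ {1, …, t}` in which agents `i` and `j` are adjacent, and `0` if there is
no such round. -/
noncomputable def lastComm (G : ℕ → SimpleGraph (Fin M)) (i j : Fin M) (t : ℕ) : ℕ :=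
  {s ∈ Finset.Icc 1 t | (G s).Adj i j}.sup id

/-- `Ñ`: the number of observations of arm `k` known to agent `i` at the end of round `t`: its own
pulls up to round `t`, and those of every other agent `j` up to the last communication of `i`
with `j`. -/
noncomputable def knownPulls (a : ℕ → Fin M → Fin K) (G : ℕ → SimpleGraph (Fin M))
    (i : Fin M) (k : Fin K) (t : ℕ) : ℕ :=
  pulls a i k t + ∑ j ∈ univ.erase i, pulls a j k (lastComm G i j t)

/-- The average of the observations of arm `k` known to agent `i` at the end of round `t`. -/
noncomputable def knownMean (a : ℕ → Fin M → Fin K) (r : ℕ → Fin M → Fin K → ℝ)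
    (G : ℕ → SimpleGraph (Fin M)) (i : Fin M) (k : Fin K) (t : ℕ) : ℝ :=
  (rewardSum a r i k t + ∑ j ∈ univ.erase i, rewardSum a r j k (lastComm G i j t)) /
    (knownPulls a G i k t : ℝ)

/-- The UCB index of arm `k` used by agent `i` to choose its arm in round `t`.  It is computed from
what the agent knows when round `t` starts; `c` is the exploration constant. -/
noncomputable def ucbIndex (c : ℝ) (a : ℕ → Fin M → Fin K) (r : ℕ → Fin M → Fin K → ℝ)
    (G : ℕ → SimpleGraph (Fin M)) (i : Fin M) (k : Fin K) (t : ℕ) : ℝ :=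
  knownMean a r G i k (t - 1) + √(c * Real.log t / (knownPulls a G i k (t - 1) : ℝ))

open Classical in
/-- The set of the arms with the highest UCB index for agent `i` in round `t`. -/
noncomputable def bestArms (c : ℝ) (a : ℕ → Fin M → Fin K) (r : ℕ → Fin M → Fin K → ℝ)
    (G : ℕ → SimpleGraph (Fin M)) (i : Fin M) (t : ℕ) : Finset (Fin K) :=
  {k | ∀ l, ucbIndex c a r G i l t ≤ ucbIndex c a r G i k t}

/-! ## The algorithm -/

/-- A deterministic rule for breaking ties: in round `t`, agent `i` picks `tie t i S` out of a
nonempty set `S` of arms. -/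
def IsTieRule (tie : ℕ → Fin M → Finset (Fin K) → Fin K) : Prop :=
  ∀ t i S, S.Nonempty → tie t i S ∈ S

/-- The cooperative UCB algorithm: `coopUCB c tie r G t i` is the arm that agent `i` pulls in round
`t`.  In rounds `1, …, K` every agent pulls the arms one by one; in every later round every agent
pulls an arm of highest UCB index.  The recursion gives the choice access to the actions of
earlier rounds only; see `coopUCB_eq`. -/
noncomputable def coopUCB (c : ℝ) (tie : ℕ → Fin M → Finset (Fin K) → Fin K)
    (r : ℕ → Fin M → Fin K → ℝ) (G : ℕ → SimpleGraph (Fin M)) (t : ℕ) (i : Fin M) : Fin K :=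
  if h : 1 ≤ t ∧ t ≤ K then ⟨t - 1, by omega⟩
  else tie t i (bestArms c
    (fun s j => if _h : s < t then coopUCB c tie r G s j else tie s j univ) r G i t)
termination_by t

lemma pulls_congr {a b : ℕ → Fin M → Fin K} {t : ℕ} (h : ∀ s, 1 ≤ s → s ≤ t → a s = b s)
    (i : Fin M) (k : Fin K) {u : ℕ} (hu : u ≤ t) : pulls a i k u = pulls b i k u := by
  unfold pulls
  congr 1
  refine Finset.filter_congr fun s hs => ?_
  rw [Finset.mem_Icc] at hs
  rw [h s hs.1 (hs.2.trans hu)]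

lemma rewardSum_congr {a b : ℕ → Fin M → Fin K} {t : ℕ} (h : ∀ s, 1 ≤ s → s ≤ t → a s = b s)
    (r : ℕ → Fin M → Fin K → ℝ) (i : Fin M) (k : Fin K) {u : ℕ} (hu : u ≤ t) :
    rewardSum a r i k u = rewardSum b r i k u := by
  unfold rewardSum
  refine Finset.sum_congr (Finset.filter_congr fun s hs => ?_) fun _ _ => rfl
  rw [Finset.mem_Icc] at hs
  rw [h s hs.1 (hs.2.trans hu)]

open Classical in
lemma lastComm_le (G : ℕ → SimpleGraph (Fin M)) (i j : Fin M) (t : ℕ) : lastComm G i j t ≤ t := by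
  unfold lastComm
  refine Finset.sup_le fun s hs => ?_
  exact (Finset.mem_Icc.mp (Finset.mem_filter.mp hs).1).2

lemma bestArms_congr (c : ℝ) {a b : ℕ → Fin M → Fin K} {t : ℕ}
    (h : ∀ s, 1 ≤ s → s ≤ t - 1 → a s = b s)
    (r : ℕ → Fin M → Fin K → ℝ) (G : ℕ → SimpleGraph (Fin M)) (i : Fin M) :
    bestArms c a r G i t = bestArms c b r G i t := by
  have h1 : ∀ k, knownPulls a G i k (t - 1) = knownPulls b G i k (t - 1) := fun k => by
    unfold knownPulls
    rw [pulls_congr h i k le_rfl]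
    congr 1
    exact Finset.sum_congr rfl fun j _ => pulls_congr h j k (lastComm_le G i j _)
  have h2 : ∀ k, knownMean a r G i k (t - 1) = knownMean b r G i k (t - 1) := fun k => by
    unfold knownMean
    rw [rewardSum_congr h r i k le_rfl, h1]
    congr 2
    exact Finset.sum_congr rfl fun j _ => rewardSum_congr h r j k (lastComm_le G i j _)
  unfold bestArms ucbIndex
  simp only [h1, h2]

/-- The actions of the algorithm satisfy the defining rule of cooperative UCB. -/
theorem coopUCB_eq (c : ℝ) (tie : ℕ → Fin M → Finset (Fin K) → Fin K)
    (r : ℕ → Fin M → Fin K → ℝ) (G : ℕ → SimpleGraph (Fin M)) (t : ℕ) (i : Fin M) :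
    coopUCB c tie r G t i =
      if h : 1 ≤ t ∧ t ≤ K then ⟨t - 1, by omega⟩
      else tie t i (bestArms c (coopUCB c tie r G) r G i t) := by
  rw [coopUCB]
  congr 1
  funext _
  congr 1
  refine bestArms_congr c (fun s hs hst => ?_) r G i
  funext j
  rw [dif_pos (by omega)]

/-! ## Regret -/

/-- `Δ_k`: the difference between the mean reward of arm `kstar` and that of arm `k`, where `ν k` is
the reward distribution of arm `k`, common to all agents. -/
noncomputable def gap (ν : Fin K → Measure ℝ) (kstar k : Fin K) : ℝ :=
  ∫ x, x ∂(ν kstar) - ∫ x, x ∂(ν k)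

/-- `R_T`: the regret after `T` rounds, averaged over the `M` agents. -/
noncomputable def regret (Δ : Fin K → ℝ) (a : ℕ → Fin M → Fin K) (T : ℕ) : ℝ :=
  (1 / (M : ℝ)) * ∑ k, ∑ i, Δ k * (pulls a i k T : ℝ)

/-- The regret of the cooperative UCB algorithm on the random rewards `r` and graphs `G`, as a
random variable. -/
noncomputable def ucbRegret {Ω : Type*} (c : ℝ) (tie : ℕ → Fin M → Finset (Fin K) → Fin K)
    (Δ : Fin K → ℝ) (r : ℕ → Fin M → Fin K → Ω → ℝ) (G : ℕ → Ω → SimpleGraph (Fin M)) (T : ℕ)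
    (ω : Ω) : ℝ :=
  regret Δ (coopUCB c tie (fun t i k => r t i k ω) (fun t => G t ω)) T

/-! ## The random environment -/

/-- The single-cluster environment on a probability space `(Ω, P)`: the reward `r t i k` of arm `k`
for agent `i` in round `t` has distribution `ν k`, which does not depend on the agent; every pair
of distinct agents is adjacent in the graph `G t` of round `t` with probability `p`; and all these
rewards and edge indicators, over all rounds, agents, arms and pairs of agents, are mutually
independent. -/
structure IsEnvironment {Ω : Type*} [MeasurableSpace Ω] (P : Measure Ω)
    (ν : Fin K → Measure ℝ) (p : ℝ)
    (r : ℕ → Fin M → Fin K → Ω → ℝ) (G : ℕ → Ω → SimpleGraph (Fin M)) : Prop where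
  measurable_reward : ∀ t i k, Measurable (r t i k)
  reward_law : ∀ t i k, P.map (r t i k) = ν k
  measurable_edge : ∀ t i j, MeasurableSet {ω | (G t ω).Adj i j}
  edge_prob : ∀ t i j, i ≠ j → P.real {ω | (G t ω).Adj i j} = p
  indep : iIndepFun (Sum.elim
    (fun x : ℕ × Fin M × Fin K => r x.1 x.2.1 x.2.2)
    (fun y : ℕ × {e : Fin M × Fin M // e.1 < e.2} =>
      Set.indicator {ω | (G y.1 ω).Adj y.2.1.1 y.2.1.2} (fun _ => (1 : ℝ)))) P

end CoopBandit

namespace CoopBandit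

variable {M K : ℕ}

/-! ## What an agent knows -/

/-! Fix a suboptimal arm `k` with gap `Δ` and put `L = 4 c log T / Δ²`. After the initial rounds an
agent pulls `k` only if it misjudges `k` or the optimal arm, or if it knows at most `L` observations
of `k`. Pulls are counted over all agents together. Once that total exceeds `L`, one complete graph
informs everybody for good. Until then the level is `Pending`, and each pending round costs at most
`M` pulls. `totalPulls_coopUCB_le` is this accounting, valid on every run.

Pending time: the pulls of a round are fixed before its graph is drawn, and that graph is complete
with probability at least `p ^ (M ^ 2)`, independently of the past. The expected number of pending
rounds is therefore at most `1 / p ^ (M ^ 2)` (`sum_pending_le`).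

Misjudgements: whether an observation is known may depend on later graphs, but not on the value of
that reward. Hence the exponential of the known centered sum, with its variance compensator, has
integral at most 1 (`lintegral_exp_knownSum_le_one`). The number of known observations is random, so
its range is cut into geometric slices (`deviation_le`). This gives `O(log t) t ^ (-α)` with `α >
1`, which is where `c > 2σ²` enters.

That number can be as small as 1 and as large as `M t`, and slicing the whole range would cost a
factor `log M`. For `t ≥ M` the range lies in `[1, t²]`. For `t < M` an agent that has just met all
others knows at least `M` observations, and the range lies in `[M, M t²]`. The exceptional event has
total cost at most `M² (1 - p) ≤ 1 / p ^ (M ^ 2)` per agent (`misjudges_le`, `sq_mul_one_sub_le`).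
-/

/-- At the end of round `u`, agent `i` knows what agent `j` observed in round `s`. -/
def Knows (G : ℕ → SimpleGraph (Fin M)) (i j : Fin M) (u s : ℕ) : Prop :=
  j = i ∨ ∃ x ∈ Finset.Icc s u, (G x).Adj i j

/-- The condition `1 ≤ s` matters: without any communication `lastComm` takes the default value 0,
and `0 ≤ 0` would hold with no witness. -/
lemma le_lastComm_iff (G : ℕ → SimpleGraph (Fin M)) (i j : Fin M) {u s : ℕ} (hs : 1 ≤ s) :
    s ≤ lastComm G i j u ↔ ∃ x ∈ Finset.Icc s u, (G x).Adj i j := by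
  classical
  unfold lastComm
  rw [Finset.le_sup_iff (by simpa using (by omega : 0 < s))]
  constructor
  · rintro ⟨x, hx, h⟩
    simp only [Finset.mem_filter, Finset.mem_Icc, id] at hx h
    exact ⟨x, by simp; omega, hx.2⟩
  · rintro ⟨x, hx, h⟩
    simp only [Finset.mem_Icc] at hx
    exact ⟨x, by simp; exact ⟨by omega, h⟩, hx.1⟩

/-- The sum over the observations of arm `k` known to agent `i` at the end of round `u`. -/
noncomputable def knownSum (a : ℕ → Fin M → Fin K) (r : ℕ → Fin M → Fin K → ℝ)
    (G : ℕ → SimpleGraph (Fin M)) (i : Fin M) (k : Fin K) (u : ℕ) : ℝ :=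
  rewardSum a r i k u + ∑ j ∈ univ.erase i, rewardSum a r j k (lastComm G i j u)

lemma pulls_eq_rewardSum (a : ℕ → Fin M → Fin K) (i : Fin M) (k : Fin K) (t : ℕ) :
    (pulls a i k t : ℝ) = rewardSum a (fun _ _ _ => 1) i k t := by
  simp [pulls, rewardSum]

/-- Lets facts about sums of rewards, such as measurability, be specialised to counts. -/
lemma knownPulls_eq_knownSum (a : ℕ → Fin M → Fin K) (G : ℕ → SimpleGraph (Fin M))
    (i : Fin M) (k : Fin K) (u : ℕ) :
    (knownPulls a G i k u : ℝ) = knownSum a (fun _ _ _ => 1) G i k u := by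
  simp [knownPulls, knownSum, pulls_eq_rewardSum]

lemma rewardSum_eq (a : ℕ → Fin M → Fin K) (r : ℕ → Fin M → Fin K → ℝ)
    (i : Fin M) (k : Fin K) {t u : ℕ} (h : t ≤ u) :
    rewardSum a r i k t = ∑ s ∈ Finset.Icc 1 u, if a s i = k ∧ s ≤ t then r s i k else 0 := by
  unfold rewardSum
  rw [← Finset.sum_filter]
  refine Finset.sum_congr ?_ fun _ _ => rfl
  ext s
  simp only [Finset.mem_filter, Finset.mem_Icc]
  constructor
  · rintro ⟨h1, h2⟩; exact ⟨by omega, h2, h1.2⟩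
  · rintro ⟨h1, h2, h3⟩; exact ⟨by omega, h2⟩

-- Writing the sum over a fixed index set of pairs `(s, j)` with random selection turns its
-- exponential into a product with one factor per reward.
open Classical in
lemma knownSum_eq (a : ℕ → Fin M → Fin K) (r : ℕ → Fin M → Fin K → ℝ)
    (G : ℕ → SimpleGraph (Fin M)) (i : Fin M) (k : Fin K) (u : ℕ) :
    knownSum a r G i k u =
      ∑ s ∈ Finset.Icc 1 u, ∑ j, if a s j = k ∧ Knows G i j u s then r s j k else 0 := by
  unfold knownSum
  rw [Finset.sum_comm, ← Finset.add_sum_erase _ _ (Finset.mem_univ i)]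
  congr 1
  · rw [rewardSum_eq a r i k le_rfl]
    refine Finset.sum_congr rfl fun s hs => ?_
    have := (Finset.mem_Icc.mp hs).2
    simp [Knows, this]
  · refine Finset.sum_congr rfl fun j hj => ?_
    rw [rewardSum_eq a r j k (lastComm_le G i j u)]
    refine Finset.sum_congr rfl fun s hs => ?_
    have := Finset.ne_of_mem_erase hj
    simp [Knows, this, le_lastComm_iff G i j (Finset.mem_Icc.mp hs).1]

open Classical in
lemma knownPulls_eq (a : ℕ → Fin M → Fin K) (G : ℕ → SimpleGraph (Fin M))
    (i : Fin M) (k : Fin K) (u : ℕ) :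
    (knownPulls a G i k u : ℝ) =
      ∑ s ∈ Finset.Icc 1 u, ∑ j, if a s j = k ∧ Knows G i j u s then (1 : ℝ) else 0 := by
  rw [knownPulls_eq_knownSum, knownSum_eq]

lemma knownSum_sub_const (a : ℕ → Fin M → Fin K) (r : ℕ → Fin M → Fin K → ℝ)
    (G : ℕ → SimpleGraph (Fin M)) (i : Fin M) (k : Fin K) (u : ℕ) (m : ℝ) :
    knownSum a (fun s j l => r s j l - m) G i k u =
      knownSum a r G i k u - m * knownPulls a G i k u := by
  classical
  rw [knownPulls_eq, knownSum_eq, knownSum_eq, Finset.mul_sum, ← Finset.sum_sub_distrib]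
  refine Finset.sum_congr rfl fun s _ => ?_
  rw [Finset.mul_sum, ← Finset.sum_sub_distrib]
  refine Finset.sum_congr rfl fun j _ => ?_
  split_ifs <;> simp

lemma knownMean_eq (a : ℕ → Fin M → Fin K) (r : ℕ → Fin M → Fin K → ℝ)
    (G : ℕ → SimpleGraph (Fin M)) (i : Fin M) (k : Fin K) (u : ℕ) :
    knownMean a r G i k u = knownSum a r G i k u / knownPulls a G i k u := rfl

lemma pulls_mono (a : ℕ → Fin M → Fin K) (i : Fin M) (k : Fin K) {s t : ℕ} (h : s ≤ t) :
    pulls a i k s ≤ pulls a i k t := by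
  unfold pulls
  exact Finset.card_le_card (Finset.filter_subset_filter _ (Finset.Icc_subset_Icc_right h))

lemma pulls_le (a : ℕ → Fin M → Fin K) (i : Fin M) (k : Fin K) (t : ℕ) :
    pulls a i k t ≤ t := by
  unfold pulls
  exact (Finset.card_filter_le _ _).trans (by simp)

lemma knownPulls_le (a : ℕ → Fin M → Fin K) (G : ℕ → SimpleGraph (Fin M))
    (i : Fin M) (k : Fin K) (u : ℕ) : knownPulls a G i k u ≤ M * u := by
  unfold knownPulls
  have : ∑ j ∈ univ.erase i, pulls a j k (lastComm G i j u) ≤ ∑ j ∈ univ.erase i, u :=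
    Finset.sum_le_sum fun j _ => (pulls_le a j k _).trans (lastComm_le G i j u)
  calc _ ≤ u + ∑ j ∈ univ.erase i, u := Nat.add_le_add (pulls_le a i k u) this
    _ = ∑ _j : Fin M, u := Finset.add_sum_erase _ (fun _ => u) (Finset.mem_univ i)
    _ = M * u := by simp

/-- If agent `i` is adjacent to all others in round `s`, it then knows all pulls up to round `s`. -/
lemma sum_pulls_le_knownPulls (a : ℕ → Fin M → Fin K) (G : ℕ → SimpleGraph (Fin M))
    (i : Fin M) (k : Fin K) {s u : ℕ} (hs : 1 ≤ s) (hu : s ≤ u)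
    (h : ∀ j, j ≠ i → (G s).Adj i j) :
    ∑ j, pulls a j k s ≤ knownPulls a G i k u := by
  unfold knownPulls
  rw [← Finset.add_sum_erase _ _ (Finset.mem_univ i)]
  refine Nat.add_le_add (pulls_mono a i k hu) (Finset.sum_le_sum fun j hj => ?_)
  refine pulls_mono a j k ((le_lastComm_iff G i j hs).2 ⟨s, by simp [hu], ?_⟩)
  exact h j (Finset.ne_of_mem_erase hj)

/-! ## The actions of the algorithm -/

/-- Agent `i` misjudges arm `k`, of mean `m`, in round `t`: the error of its estimate exceeds its
confidence width. -/
def Misjudges (c : ℝ) (a : ℕ → Fin M → Fin K) (r : ℕ → Fin M → Fin K → ℝ)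
    (G : ℕ → SimpleGraph (Fin M)) (m : ℝ) (i : Fin M) (k : Fin K) (t : ℕ) : Prop :=
  √(c * Real.log t / (knownPulls a G i k (t - 1) : ℝ)) < |knownMean a r G i k (t - 1) - m|

section Algorithm

variable (c : ℝ) (tie : ℕ → Fin M → Finset (Fin K) → Fin K)
  (r : ℕ → Fin M → Fin K → ℝ) (G : ℕ → SimpleGraph (Fin M))

lemma coopUCB_init {t : ℕ} (h1 : 1 ≤ t) (h2 : t ≤ K) (i : Fin M) (k : Fin K) :
    coopUCB c tie r G t i = k ↔ t = k + 1 := by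
  rw [coopUCB_eq, dif_pos ⟨h1, h2⟩, Fin.ext_iff]
  simp only
  omega

lemma one_le_pulls_coopUCB {t : ℕ} (h : K ≤ t) (i : Fin M) (k : Fin K) :
    1 ≤ pulls (coopUCB c tie r G) i k t := by
  unfold pulls
  rw [Nat.one_le_iff_ne_zero, Finset.card_ne_zero]
  have := k.2
  exact ⟨k + 1, by
    simp only [Finset.mem_filter, Finset.mem_Icc]
    exact ⟨by omega, (coopUCB_init c tie r G (by omega) (by omega) i k).2 rfl⟩⟩

lemma one_le_knownPulls_coopUCB {t : ℕ} (h : K ≤ t) (i : Fin M) (k : Fin K) :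
    1 ≤ knownPulls (coopUCB c tie r G) G i k t :=
  (one_le_pulls_coopUCB c tie r G h i k).trans (Nat.le_add_right _ _)

lemma card_le_knownPulls_coopUCB {t : ℕ} (h0 : 1 ≤ t) (h : K ≤ t) (i : Fin M) (k : Fin K)
    (hG : ∀ j, j ≠ i → (G t).Adj i j) :
    M ≤ knownPulls (coopUCB c tie r G) G i k t := by
  refine le_trans ?_ (sum_pulls_le_knownPulls _ G i k h0 le_rfl hG)
  calc M = ∑ _j : Fin M, 1 := by simp
    _ ≤ _ := Finset.sum_le_sum fun j _ => one_le_pulls_coopUCB c tie r G h j k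

lemma ucbIndex_le_of_coopUCB_eq (hK : 1 ≤ K) (htie : IsTieRule tie) {t : ℕ} (ht : K < t)
    {i : Fin M} {k : Fin K} (h : coopUCB c tie r G t i = k) (l : Fin K) :
    ucbIndex c (coopUCB c tie r G) r G i l t ≤ ucbIndex c (coopUCB c tie r G) r G i k t := by
  classical
  rw [coopUCB_eq, dif_neg (by omega)] at h
  have hne : (bestArms c (coopUCB c tie r G) r G i t).Nonempty := by
    have : Nonempty (Fin K) := ⟨⟨0, hK⟩⟩
    obtain ⟨x, hx⟩ := Finite.exists_max fun l => ucbIndex c (coopUCB c tie r G) r G i l t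
    exact ⟨x, by simpa [bestArms] using hx⟩
  have h2 := htie t i _ hne
  rw [h] at h2
  simp only [bestArms, Finset.mem_filter, Finset.mem_univ, true_and] at h2
  exact h2 l

/-- A suboptimal arm is pulled only after few observations, unless an arm is misjudged. -/
lemma knownPulls_le_of_coopUCB_eq (hK : 1 ≤ K) (htie : IsTieRule tie) (hc : 0 ≤ c)
    {t T : ℕ} (ht : K < t) (hT : t ≤ T) {i : Fin M} {k l : Fin K}
    (h : coopUCB c tie r G t i = k) {m m' : ℝ} (hm : m < m')
    (h1 : ¬ Misjudges c (coopUCB c tie r G) r G m i k t)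
    (h2 : ¬ Misjudges c (coopUCB c tie r G) r G m' i l t) :
    (knownPulls (coopUCB c tie r G) G i k (t - 1) : ℝ) ≤ 4 * c * Real.log T / (m' - m) ^ 2 := by
  have h3 := ucbIndex_le_of_coopUCB_eq c tie r G hK htie ht h l
  unfold Misjudges at h1 h2
  rw [not_lt, abs_le] at h1 h2
  unfold ucbIndex at h3
  set N := (knownPulls (coopUCB c tie r G) G i k (t - 1) : ℝ) with hN
  have hN1 : 1 ≤ N := by
    rw [hN]; exact_mod_cast one_le_knownPulls_coopUCB c tie r G (by omega : K ≤ t - 1) i k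
  -- Chain: `m'` is at most the index of `l`, which is at most the index of `k`, which is at most
  -- `m` plus twice the width.
  have h4 : m' - m ≤ 2 * √(c * Real.log t / N) := by linarith [h1.1, h1.2, h2.1, h2.2]
  have hlog : 0 ≤ Real.log t := Real.log_natCast_nonneg t
  have hle : Real.log t ≤ Real.log T := by
    apply Real.log_le_log
    · exact_mod_cast (by omega : 0 < t)
    · exact_mod_cast hT
  have h5 : (m' - m) ^ 2 ≤ 4 * (c * Real.log t / N) := by
    calc (m' - m) ^ 2 ≤ (2 * √(c * Real.log t / N)) ^ 2 :=
          pow_le_pow_left₀ (by linarith) h4 2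
      _ = 4 * (c * Real.log t / N) := by
          rw [mul_pow, Real.sq_sqrt (by positivity)]; ring
  rw [le_div_iff₀ (by have : 0 < m' - m := by linarith
                      positivity)]
  calc N * (m' - m) ^ 2 ≤ N * (4 * (c * Real.log t / N)) := by gcongr
    _ = 4 * c * Real.log t := by field_simp
    _ ≤ 4 * c * Real.log T := by gcongr

end Algorithm

/-! ## Counting pulls -/

/-- The number of pulls of arm `k` by all agents in rounds `1, …, t`. -/
def totalPulls (a : ℕ → Fin M → Fin K) (k : Fin K) (t : ℕ) : ℕ := ∑ i, pulls a i k t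

lemma pulls_succ (a : ℕ → Fin M → Fin K) (i : Fin M) (k : Fin K) (t : ℕ) :
    pulls a i k (t + 1) = pulls a i k t + if a (t + 1) i = k then 1 else 0 := by
  unfold pulls
  rw [← Finset.insert_Icc_right_eq_Icc_add_one (by omega), Finset.filter_insert]
  split_ifs
  · rw [Finset.card_insert_of_notMem (by simp)]
  · rfl

lemma pulls_zero (a : ℕ → Fin M → Fin K) (i : Fin M) (k : Fin K) : pulls a i k 0 = 0 := by
  simp [pulls]

lemma totalPulls_zero (a : ℕ → Fin M → Fin K) (k : Fin K) : totalPulls a k 0 = 0 := by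
  simp [totalPulls, pulls_zero]

lemma totalPulls_succ (a : ℕ → Fin M → Fin K) (k : Fin K) (t : ℕ) :
    totalPulls a k (t + 1) = totalPulls a k t + #{i | a (t + 1) i = k} := by
  simp [totalPulls, pulls_succ, Finset.sum_add_distrib]

lemma totalPulls_mono (a : ℕ → Fin M → Fin K) (k : Fin K) {s t : ℕ} (h : s ≤ t) :
    totalPulls a k s ≤ totalPulls a k t :=
  Finset.sum_le_sum fun i _ => pulls_mono a i k h

/-- The pulls of arm `k` have exceeded the level `L` by the end of round `t`, but there has been no
round with a complete graph since. -/
def Pending (a : ℕ → Fin M → Fin K) (G : ℕ → SimpleGraph (Fin M)) (k : Fin K) (L : ℝ)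
    (t : ℕ) : Prop :=
  L < totalPulls a k t ∧
    ∀ s ∈ Finset.Icc 1 t, L < totalPulls a k s → ∃ i j, i ≠ j ∧ ¬ (G s).Adj i j

/-- A complete graph in a round whose total already exceeds `L` would have told agent `i` more than
`L` observations, and known counts never drop. -/
lemma pending_of_knownPulls_le {a : ℕ → Fin M → Fin K} {G : ℕ → SimpleGraph (Fin M)} {k : Fin K}
    {L : ℝ} {t : ℕ} {i : Fin M} (h1 : L < totalPulls a k t)
    (h2 : (knownPulls a G i k t : ℝ) ≤ L) : Pending a G k L t := by
  refine ⟨h1, fun s hs h3 => ?_⟩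
  by_contra! h4
  rw [Finset.mem_Icc] at hs
  have h5 := sum_pulls_le_knownPulls a G i k hs.1 hs.2 fun j hj => h4 i j hj.symm
  have h6 : (totalPulls a k s : ℝ) ≤ knownPulls a G i k t := by exact_mod_cast h5
  linarith

-- Induction on `t`: each term on the right pays for one kind of pull. The first pays for the
-- initial pulls, the `min` for those made while the total is at most `L` (it overshoots by at most
-- `M`), and the two sums for the rest. The level uses `T`, so it stays fixed during the induction.
open Classical in
lemma totalPulls_coopUCB_le (c : ℝ) (tie : ℕ → Fin M → Finset (Fin K) → Fin K)
    (r : ℕ → Fin M → Fin K → ℝ) (G : ℕ → SimpleGraph (Fin M)) (hK : 1 ≤ K)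
    (htie : IsTieRule tie) (hc : 0 ≤ c) {k l : Fin K} {m m' : ℝ} (hm : m < m') (T t : ℕ)
    (ht : t ≤ T) :
    (totalPulls (coopUCB c tie r G) k t : ℝ) ≤
      (if t ≤ k then 0 else (M : ℝ)) +
      min (totalPulls (coopUCB c tie r G) k t : ℝ) (4 * c * Real.log T / (m' - m) ^ 2 + M) +
      M * ∑ s ∈ Finset.range t,
        (if Pending (coopUCB c tie r G) G k (4 * c * Real.log T / (m' - m) ^ 2) s
          then (1 : ℝ) else 0) +
      ∑ s ∈ Finset.Ioc K t, ∑ i,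
        ((if Misjudges c (coopUCB c tie r G) r G m i k s then (1 : ℝ) else 0) +
          if Misjudges c (coopUCB c tie r G) r G m' i l s then (1 : ℝ) else 0) := by
  set L := 4 * c * Real.log T / (m' - m) ^ 2 with hL
  set a := coopUCB c tie r G with ha
  have hL0 : 0 ≤ L := by
    have : 0 ≤ Real.log T := Real.log_natCast_nonneg T
    positivity
  induction t with
  | zero =>
    have : (0 : ℝ) ≤ L + M := by positivity
    simp [totalPulls_zero, this]
  | succ t ih =>
    have ih := ih (by omega)
    have hn : (#{i | a (t + 1) i = k} : ℝ) ≤ M := by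
      exact_mod_cast (Finset.card_filter_le _ _).trans (by simp)
    have hsucc : (totalPulls a k (t + 1) : ℝ) = totalPulls a k t + #{i | a (t + 1) i = k} := by
      rw [totalPulls_succ]; push_cast; rfl
    have hmin : min (totalPulls a k t : ℝ) (L + M) ≤ min (totalPulls a k (t + 1) : ℝ) (L + M) := by
      apply min_le_min_right
      exact_mod_cast totalPulls_mono a k (by omega)
    rw [Finset.sum_range_succ]
    have hP : (0 : ℝ) ≤ if Pending a G k L t then (1 : ℝ) else 0 := by split_ifs <;> norm_num
    have hM0 : (0 : ℝ) ≤ M := by positivity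
    have hPM := mul_nonneg hM0 hP
    rcases le_or_gt (t + 1) K with h | h
    · rw [Finset.Ioc_eq_empty (by omega)]
      rw [Finset.Ioc_eq_empty (by omega)] at ih
      by_cases hk : t + 1 = k + 1
      · rw [if_neg (by omega)]
        rw [if_pos (by omega)] at ih
        linarith
      · have h0 : #{i | a (t + 1) i = k} = 0 := by
          rw [Finset.card_eq_zero, Finset.filter_eq_empty_iff]
          intro i _ hi
          exact hk ((coopUCB_init c tie r G (by omega) h i k).1 hi)
        rw [h0, Nat.cast_zero, add_zero] at hsucc
        have : (if t ≤ (k : ℕ) then (0 : ℝ) else M) ≤ if t + 1 ≤ (k : ℕ) then (0 : ℝ) else M := by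
          split_ifs
          all_goals first | omega | simp
        linarith
    · have hk := k.2
      rw [if_neg (by omega)]
      have hif : (if t ≤ (k : ℕ) then (0 : ℝ) else M) ≤ M := by split_ifs <;> simp
      rw [← Finset.insert_Ioc_right_eq_Ioc_add_one (by omega), Finset.sum_insert (by simp)]
      by_cases hS : (totalPulls a k t : ℝ) ≤ L
      · have h1 : min (totalPulls a k (t + 1) : ℝ) (L + M) = totalPulls a k (t + 1) :=
          min_eq_left (by linarith)
        have h2 : min (totalPulls a k t : ℝ) (L + M) = totalPulls a k t :=
          min_eq_left (by linarith)
        have h3 : (0 : ℝ) ≤ ∑ i, ((if Misjudges c a r G m i k (t + 1) then (1 : ℝ) else 0) +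
            if Misjudges c a r G m' i l (t + 1) then (1 : ℝ) else 0) :=
          Finset.sum_nonneg fun i _ => by split_ifs <;> norm_num
        linarith
      -- Above the level, each agent pulling `k` is charged to its own misjudgement or to the
      -- pending state.
      · have h1 : (#{i | a (t + 1) i = k} : ℝ) ≤ M * (if Pending a G k L t then (1 : ℝ) else 0) +
            ∑ i, ((if Misjudges c a r G m i k (t + 1) then (1 : ℝ) else 0) +
            if Misjudges c a r G m' i l (t + 1) then (1 : ℝ) else 0) := by
          have : (M : ℝ) * (if Pending a G k L t then (1 : ℝ) else 0) =
              ∑ _i : Fin M, (if Pending a G k L t then (1 : ℝ) else 0) := by simp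
          rw [this, ← Finset.sum_add_distrib, Finset.card_filter, Nat.cast_sum]
          refine Finset.sum_le_sum fun i _ => ?_
          by_cases hi : a (t + 1) i = k
          · by_cases hm1 : Misjudges c a r G m i k (t + 1)
            · simp only [hi, hm1, if_true]; split_ifs <;> norm_num
            by_cases hm2 : Misjudges c a r G m' i l (t + 1)
            · simp only [hi, hm2, if_true]; split_ifs <;> norm_num
            have h7 := knownPulls_le_of_coopUCB_eq c tie r G hK htie hc h ht hi hm hm1 hm2
            rw [Nat.add_sub_cancel] at h7
            have h8 := pending_of_knownPulls_le (not_le.1 hS) h7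
            simp only [hi, h8, if_true]; split_ifs; norm_num
          · simp only [hi, if_false]; split_ifs <;> norm_num
        linarith

/-! ## Measurability -/

section Measurability

variable {Ω : Type*} {m : MeasurableSpace Ω} {a : Ω → ℕ → Fin M → Fin K}
  {r : Ω → ℕ → Fin M → Fin K → ℝ} {G : Ω → ℕ → SimpleGraph (Fin M)}

lemma measurableSet_knows {u s : ℕ} (i j : Fin M)
    (hG : ∀ x ≤ u, MeasurableSet {ω | (G ω x).Adj i j}) :
    MeasurableSet {ω | Knows (G ω) i j u s} := by
  have : {ω | Knows (G ω) i j u s} =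
      {_ω | j = i} ∪ ⋃ x ∈ Finset.Icc s u, {ω | (G ω x).Adj i j} := by
    ext ω; simp [Knows]
  rw [this]
  refine (MeasurableSet.const _).union (Finset.measurableSet_biUnion _ fun x hx => hG x ?_)
  exact (Finset.mem_Icc.mp hx).2

lemma measurable_knownSum {u : ℕ} (i : Fin M) (k : Fin K)
    (ha : ∀ s, 1 ≤ s → s ≤ u → ∀ j, MeasurableSet {ω | a ω s j = k})
    (hr : ∀ s ≤ u, ∀ j, Measurable fun ω => r ω s j k)
    (hG : ∀ s ≤ u, ∀ j, MeasurableSet {ω | (G ω s).Adj i j}) :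
    Measurable fun ω => knownSum (a ω) (r ω) (G ω) i k u := by
  classical
  simp_rw [knownSum_eq]
  refine Finset.measurable_fun_sum _ fun s hs => Finset.measurable_fun_sum _ fun j _ => ?_
  rw [Finset.mem_Icc] at hs
  exact Measurable.ite ((ha s hs.1 hs.2 j).inter
    (measurableSet_knows i j fun x hx => hG x hx j)) (hr s hs.2 j) measurable_const

lemma measurable_knownPulls {u : ℕ} (i : Fin M) (k : Fin K)
    (ha : ∀ s, 1 ≤ s → s ≤ u → ∀ j, MeasurableSet {ω | a ω s j = k})
    (hG : ∀ s ≤ u, ∀ j, MeasurableSet {ω | (G ω s).Adj i j}) :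
    Measurable fun ω => (knownPulls (a ω) (G ω) i k u : ℝ) := by
  simp_rw [knownPulls_eq_knownSum]
  exact measurable_knownSum (r := fun _ _ _ _ => 1) i k ha (fun _ _ _ => measurable_const) hG

lemma measurable_knownMean {u : ℕ} (i : Fin M) (k : Fin K)
    (ha : ∀ s, 1 ≤ s → s ≤ u → ∀ j, MeasurableSet {ω | a ω s j = k})
    (hr : ∀ s ≤ u, ∀ j, Measurable fun ω => r ω s j k)
    (hG : ∀ s ≤ u, ∀ j, MeasurableSet {ω | (G ω s).Adj i j}) :
    Measurable fun ω => knownMean (a ω) (r ω) (G ω) i k u := by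
  simp_rw [knownMean_eq]
  exact (measurable_knownSum i k ha hr hG).div (measurable_knownPulls i k ha hG)

/-- The action in round `t` is a measurable function of the rewards and graphs of the earlier
rounds. -/
lemma measurableSet_coopUCB (c : ℝ) (tie : ℕ → Fin M → Finset (Fin K) → Fin K) (t : ℕ)
    (hr : ∀ s < t, ∀ j k, Measurable fun ω => r ω s j k)
    (hG : ∀ s < t, ∀ i j, MeasurableSet {ω | (G ω s).Adj i j}) (i : Fin M) (k : Fin K) :
    MeasurableSet {ω | coopUCB c tie (r ω) (G ω) t i = k} := by
  classical
  induction t using Nat.strong_induction_on generalizing i k with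
  | _ t ih =>
  by_cases h : 1 ≤ t ∧ t ≤ K
  · simp_rw [coopUCB_eq, dif_pos h]
    exact MeasurableSet.const _
  simp_rw [coopUCB_eq, dif_neg h]
  have hucb : ∀ l, Measurable fun ω =>
      ucbIndex c (coopUCB c tie (r ω) (G ω)) (r ω) (G ω) i l t := by
    intro l
    unfold ucbIndex
    -- For `t = 0` the truncated `t - 1` is not an earlier round, so the hypotheses say nothing; but
    -- all statistics at 0 are constant.
    rcases Nat.eq_zero_or_pos t with h0 | h0
    · subst h0
      simp [knownMean, knownPulls, rewardSum, pulls, lastComm]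
    have ha : ∀ s, 1 ≤ s → s ≤ t - 1 → ∀ j,
        MeasurableSet {ω | coopUCB c tie (r ω) (G ω) s j = l} := fun s _ h2 j =>
      ih s (by omega) (fun s' hs' => hr s' (by omega)) (fun s' hs' => hG s' (by omega)) j l
    refine (measurable_knownMean i l ha (fun s hs j => hr s (by omega) j l)
      (fun s hs j => hG s (by omega) i j)).add (Measurable.sqrt ?_)
    exact measurable_const.div (measurable_knownPulls i l ha (fun s hs j => hG s (by omega) i j))
  have hmem : ∀ l, MeasurableSet
      {ω | l ∈ bestArms c (coopUCB c tie (r ω) (G ω)) (r ω) (G ω) i t} := by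
    intro l
    simp only [bestArms, Finset.mem_filter, Finset.mem_univ, true_and]
    rw [Set.ofPred_forall]
    exact MeasurableSet.iInter fun l' => measurableSet_le (hucb l') (hucb l)
  have hS : ∀ S, MeasurableSet
      {ω | bestArms c (coopUCB c tie (r ω) (G ω)) (r ω) (G ω) i t = S} := by
    intro S
    simp only [Finset.ext_iff]
    rw [Set.ofPred_forall]
    refine MeasurableSet.iInter fun l => ?_
    by_cases hl : l ∈ S
    · simpa only [hl, iff_true] using hmem l
    · simp only [hl, iff_false]
      exact (hmem l).compl
  -- The tie rule is an arbitrary function, but its argument takes finitely many values.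
  have : {ω | tie t i (bestArms c (coopUCB c tie (r ω) (G ω)) (r ω) (G ω) i t) = k} =
      ⋃ S ∈ ({S | tie t i S = k} : Finset (Finset (Fin K))),
        {ω | bestArms c (coopUCB c tie (r ω) (G ω)) (r ω) (G ω) i t = S} := by
    ext ω; simp
  rw [this]
  exact Finset.measurableSet_biUnion _ fun S _ => hS S

lemma measurable_pulls (i : Fin M) (k : Fin K) (t : ℕ)
    (ha : ∀ s, 1 ≤ s → s ≤ t → MeasurableSet {ω | a ω s i = k}) :
    Measurable fun ω => (pulls (a ω) i k t : ℝ) := by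
  simp_rw [pulls, Finset.card_filter, Nat.cast_sum, Nat.cast_ite, Nat.cast_one, Nat.cast_zero]
  refine Finset.measurable_fun_sum _ fun s hs => ?_
  rw [Finset.mem_Icc] at hs
  exact Measurable.ite (ha s hs.1 hs.2) measurable_const measurable_const

lemma measurable_totalPulls (k : Fin K) (t : ℕ)
    (ha : ∀ s, 1 ≤ s → s ≤ t → ∀ i, MeasurableSet {ω | a ω s i = k}) :
    Measurable fun ω => (totalPulls (a ω) k t : ℝ) := by
  simp_rw [totalPulls, Nat.cast_sum]
  exact Finset.measurable_fun_sum _ fun i _ => measurable_pulls i k t fun s h1 h2 => ha s h1 h2 i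

/-- Every pair of distinct agents is adjacent in `g`. -/
def AllAdj (g : SimpleGraph (Fin M)) : Prop := ∀ i j, i ≠ j → g.Adj i j

lemma measurableSet_allAdj (s : ℕ) (hG : ∀ i j, MeasurableSet {ω | (G ω s).Adj i j}) :
    MeasurableSet {ω | AllAdj (G ω s)} := by
  unfold AllAdj
  simp only [Set.ofPred_forall]
  exact MeasurableSet.iInter fun i => MeasurableSet.iInter fun j => MeasurableSet.iInter fun _ =>
    hG i j

lemma pending_iff {a : ℕ → Fin M → Fin K} {G : ℕ → SimpleGraph (Fin M)} {k : Fin K} {L : ℝ}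
    {t : ℕ} : Pending a G k L t ↔ L < totalPulls a k t ∧
      ∀ s ∈ Finset.Icc 1 t, L < totalPulls a k s → ¬ AllAdj (G s) := by
  simp [Pending, AllAdj]

lemma measurableSet_pending (k : Fin K) (L : ℝ) (t : ℕ)
    (ha : ∀ s, 1 ≤ s → s ≤ t → ∀ i, MeasurableSet {ω | a ω s i = k})
    (hG : ∀ s ≤ t, ∀ i j, MeasurableSet {ω | (G ω s).Adj i j}) :
    MeasurableSet {ω | Pending (a ω) (G ω) k L t} := by
  have : {ω | Pending (a ω) (G ω) k L t} = {ω | L < (totalPulls (a ω) k t : ℝ)} ∩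
      ⋂ s ∈ Finset.Icc 1 t,
        ({ω | L < (totalPulls (a ω) k s : ℝ)}ᶜ ∪ {ω | AllAdj (G ω s)}ᶜ) := by
    ext ω
    simp [pending_iff, imp_iff_not_or]
  rw [this]
  refine (measurableSet_lt measurable_const (measurable_totalPulls k t ha)).inter ?_
  refine MeasurableSet.iInter fun s => MeasurableSet.iInter fun hs => ?_
  rw [Finset.mem_Icc] at hs
  have h1 : MeasurableSet {ω | L < (totalPulls (a ω) k s : ℝ)} :=
    measurableSet_lt measurable_const (measurable_totalPulls k s fun s' h1 h2 => ha s' h1 (by omega))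
  exact h1.compl.union (measurableSet_allAdj s (hG s hs.2)).compl

lemma measurableSet_misjudges (c x : ℝ) (i : Fin M) (k : Fin K) (t : ℕ)
    (ha : ∀ s j, MeasurableSet {ω | a ω s j = k})
    (hr : ∀ s j, Measurable fun ω => r ω s j k)
    (hG : ∀ s j, MeasurableSet {ω | (G ω s).Adj i j}) :
    MeasurableSet {ω | Misjudges c (a ω) (r ω) (G ω) x i k t} := by
  unfold Misjudges
  refine measurableSet_lt (Measurable.sqrt (measurable_const.div
    (measurable_knownPulls i k (fun s _ _ => ha s) fun s _ => hG s))) ?_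
  exact ((measurable_knownMean i k (fun s _ _ => ha s) (fun s _ => hr s)
    fun s _ => hG s).sub_const x).abs

end Measurability

/-! ## Information in the environment -/

/-- The indices of the independent variables of the environment: rewards and edge indicators. -/
abbrev EnvIndex (M K : ℕ) : Type :=
  (ℕ × Fin M × Fin K) ⊕ (ℕ × {e : Fin M × Fin M // e.1 < e.2})

section Environment

variable {Ω : Type*} [MeasurableSpace Ω] {P : Measure Ω} {ν : Fin K → Measure ℝ} {p : ℝ}
  {r : ℕ → Fin M → Fin K → Ω → ℝ} {G : ℕ → Ω → SimpleGraph (Fin M)}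

/-- The variables of the environment: rewards and edge indicators. -/
noncomputable def envVar {Ω : Type*} (r : ℕ → Fin M → Fin K → Ω → ℝ)
    (G : ℕ → Ω → SimpleGraph (Fin M)) : EnvIndex M K → Ω → ℝ :=
  Sum.elim
    (fun x : ℕ × Fin M × Fin K => r x.1 x.2.1 x.2.2)
    (fun y : ℕ × {e : Fin M × Fin M // e.1 < e.2} =>
      Set.indicator {ω | (G y.1 ω).Adj y.2.1.1 y.2.1.2} (fun _ => (1 : ℝ)))

/-- The σ-algebra generated by the variables of the environment with index in `S`. -/
@[reducible]
noncomputable def envSigma {Ω : Type*} (r : ℕ → Fin M → Fin K → Ω → ℝ) (G : ℕ → Ω → SimpleGraph (Fin M))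
    (S : Set (EnvIndex M K)) : MeasurableSpace Ω :=
  ⨆ x ∈ S, MeasurableSpace.comap (envVar r G x) inferInstance

lemma IsEnvironment.measurable_envVar (h : IsEnvironment P ν p r G) (x : EnvIndex M K) :
    Measurable (envVar r G x) := by
  rcases x with x | y
  · exact h.measurable_reward _ _ _
  · exact measurable_const.indicator (h.measurable_edge _ _ _)

lemma IsEnvironment.envSigma_le (h : IsEnvironment P ν p r G) (S : Set (EnvIndex M K)) :
    envSigma r G S ≤ ‹MeasurableSpace Ω› :=
  iSup₂_le fun x _ => (h.measurable_envVar x).comap_le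

lemma IsEnvironment.indep_envSigma (h : IsEnvironment P ν p r G) (S : Set (EnvIndex M K)) :
    Indep (envSigma r G S) (envSigma r G Sᶜ) P :=
  indep_biSup_compl (fun x => (h.measurable_envVar x).comap_le) h.indep.iIndep S

lemma measurable_envVar_envSigma {Ω : Type*} (r : ℕ → Fin M → Fin K → Ω → ℝ)
    (G : ℕ → Ω → SimpleGraph (Fin M)) {S : Set (EnvIndex M K)} {x : EnvIndex M K} (hx : x ∈ S) :
    Measurable[envSigma r G S] (envVar r G x) :=
  Measurable.mono (comap_measurable _)
    (le_iSup₂ (f := fun x (_ : x ∈ S) => MeasurableSpace.comap (envVar r G x) inferInstance) x hx)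
    le_rfl

lemma measurable_reward_envSigma {Ω : Type*} (r : ℕ → Fin M → Fin K → Ω → ℝ)
    (G : ℕ → Ω → SimpleGraph (Fin M)) {S : Set (EnvIndex M K)} {t : ℕ} {i : Fin M} {k : Fin K}
    (hx : Sum.inl (t, i, k) ∈ S) : Measurable[envSigma r G S] (r t i k) :=
  measurable_envVar_envSigma r G hx

/-- The environment lists only edges with `i < j`; symmetry and irreflexivity supply the rest. -/
lemma measurableSet_adj_envSigma {Ω : Type*} (r : ℕ → Fin M → Fin K → Ω → ℝ)
    (G : ℕ → Ω → SimpleGraph (Fin M)) {S : Set (EnvIndex M K)} {t : ℕ}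
    (hx : ∀ e, Sum.inr (t, e) ∈ S) (i j : Fin M) :
    MeasurableSet[envSigma r G S] {ω | (G t ω).Adj i j} := by
  have key : ∀ i j : Fin M, i < j → MeasurableSet[envSigma r G S] {ω | (G t ω).Adj i j} := by
    intro i j hij
    have h1 := measurable_envVar_envSigma r G (hx ⟨(i, j), hij⟩)
    have h2 := h1 (measurableSet_singleton (1 : ℝ))
    convert h2 using 1
    ext ω
    by_cases h : (G t ω).Adj i j <;> simp [envVar, h]
  rcases lt_trichotomy i j with h | h | h
  · exact key i j h
  · subst h; simp
  · simp_rw [SimpleGraph.adj_comm _ i j]; exact key j i h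

/-- The graph of round `t` is complete with probability at least `p ^ (M ^ 2)`. -/
lemma IsEnvironment.pow_le_allAdj [IsProbabilityMeasure P] (h : IsEnvironment P ν p r G)
    (hp : 0 < p) (hp1 : p ≤ 1) (t : ℕ) :
    p ^ (M ^ 2) ≤ P.real {ω | AllAdj (G t ω)} := by
  classical
  have h1 := (h.indep.precomp (g := fun e : {e : Fin M × Fin M // e.1 < e.2} => Sum.inr (t, e))
    fun a b hab => by simpa using hab).measure_inter_preimage_eq_mul univ (sets := fun _ => {1})
    (fun _ _ => measurableSet_singleton 1)
  have h2 : ∀ e : {e : Fin M × Fin M // e.1 < e.2},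
      Set.indicator {ω | (G t ω).Adj e.1.1 e.1.2} (fun _ => (1 : ℝ)) ⁻¹' {1} =
        {ω | (G t ω).Adj e.1.1 e.1.2} := by
    intro e; ext ω
    by_cases hh : (G t ω).Adj e.1.1 e.1.2 <;> simp [hh]
  simp only [Finset.mem_univ, Set.iInter_true, Sum.elim_inr, h2] at h1
  have h3 : {ω | AllAdj (G t ω)} = ⋂ e : {e : Fin M × Fin M // e.1 < e.2},
      {ω | (G t ω).Adj e.1.1 e.1.2} := by
    ext ω
    simp only [AllAdj, Set.mem_ofPred_eq, Set.mem_iInter]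
    refine ⟨fun hh e => hh _ _ e.2.ne, fun hh i j hij => ?_⟩
    rcases lt_or_gt_of_ne hij with h' | h'
    · exact hh ⟨(i, j), h'⟩
    · exact (hh ⟨(j, i), h'⟩).symm
  rw [h3, measureReal_def, h1, ENNReal.toReal_prod]
  have h4 : ∀ e : {e : Fin M × Fin M // e.1 < e.2},
      (P {ω | (G t ω).Adj e.1.1 e.1.2}).toReal = p := fun e => h.edge_prob t _ _ e.2.ne
  simp only [h4, Finset.prod_const, Finset.card_univ]
  refine pow_le_pow_of_le_one hp.le hp1 ?_
  refine (Fintype.card_subtype_le _).trans ?_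
  simp [sq]

/-- Agent `i` is not adjacent to all others in round `t` with probability at most `M (1 - p)`. -/
lemma IsEnvironment.not_adj_le [IsProbabilityMeasure P] (h : IsEnvironment P ν p r G)
    (hp1 : p ≤ 1) (i : Fin M) (t : ℕ) :
    P.real {ω | ¬ ∀ j, j ≠ i → (G t ω).Adj i j} ≤ M * (1 - p) := by
  have h1 : {ω | ¬ ∀ j, j ≠ i → (G t ω).Adj i j} ⊆
      ⋃ j ∈ univ.erase i, {ω | (G t ω).Adj i j}ᶜ := by
    intro ω hω
    simp only [Set.mem_ofPred_eq, not_forall] at hω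
    obtain ⟨j, hj, hj2⟩ := hω
    simp only [Set.mem_iUnion]
    exact ⟨j, by simp [hj], hj2⟩
  refine (measureReal_mono h1 (measure_ne_top P _)).trans ((measureReal_biUnion_finset_le _ _).trans ?_)
  calc ∑ j ∈ univ.erase i, P.real {ω | (G t ω).Adj i j}ᶜ
      = ∑ j ∈ univ.erase i, (1 - p) := Finset.sum_congr rfl fun j hj => by
        rw [probReal_compl_eq_one_sub (h.measurable_edge t i j),
          h.edge_prob t i j (Finset.ne_of_mem_erase hj).symm]
    _ ≤ ∑ _j : Fin M, (1 - p) :=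
        Finset.sum_le_sum_of_subset_of_nonneg (Finset.erase_subset _ _)
          fun _ _ _ => sub_nonneg.2 hp1
    _ = M * (1 - p) := by simp [mul_sub]

/-! ## Exponential moments -/

/-- A variance proxy `v ≥ σ2` is carried along because the later choice of `lam` divides by `v`,
while `σ2` may be 0. -/
lemma lintegral_exp_le_one (σ2 : ℝ≥0) (v : ℝ) (hv : σ2 ≤ v) (h : IsEnvironment P ν p r G)
    {k : Fin K} (hν : HasSubgaussianMGF (fun x => x - ∫ y, y ∂(ν k)) σ2 (ν k)) (lam : ℝ)
    (s : ℕ) (j : Fin M) :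
    ∫⁻ ω, ENNReal.ofReal (Real.exp (lam * (r s j k ω - ∫ y, y ∂(ν k)) - lam ^ 2 * v / 2)) ∂P
      ≤ 1 := by
  have h1 : HasSubgaussianMGF ((fun x => x - ∫ y, y ∂(ν k)) ∘ r s j k) σ2 P := by
    refine HasSubgaussianMGF.of_map (h.measurable_reward s j k).aemeasurable ?_
    rwa [h.reward_law s j k]
  have h2 := h1.integrable_exp_mul lam
  have h3 := h1.mgf_le lam
  simp only [Function.comp_def] at h2
  have h4 : ∀ ω, Real.exp (lam * (r s j k ω - ∫ y, y ∂(ν k)) - lam ^ 2 * v / 2) =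
      Real.exp (lam * (r s j k ω - ∫ y, y ∂(ν k))) * Real.exp (- (lam ^ 2 * v / 2)) := fun ω => by
    rw [← Real.exp_add]; rfl
  simp_rw [h4]
  rw [← ofReal_integral_eq_lintegral_ofReal (h2.mul_const _)
    (Filter.Eventually.of_forall fun ω => by positivity), integral_mul_const]
  rw [← ENNReal.ofReal_one]
  refine ENNReal.ofReal_le_ofReal ?_
  calc _ ≤ Real.exp (σ2 * lam ^ 2 / 2) * Real.exp (- (lam ^ 2 * v / 2)) :=
        mul_le_mul_of_nonneg_right h3 (by positivity)
    _ = Real.exp (-(lam ^ 2 * (v - σ2) / 2)) := by rw [← Real.exp_add]; ring_nf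
    _ ≤ 1 := Real.exp_le_one_iff.2 (by
        have := mul_nonneg (sq_nonneg lam) (sub_nonneg.2 hv); linarith)

-- One peeling step: on `A` the independent factor `φ` splits off and contributes at most 1. Values
-- in `ENNReal` make integrability conditions unnecessary.
open Classical in
lemma lintegral_mul_ite_le {Ω : Type*} {m m' mΩ : MeasurableSpace Ω} {P : Measure Ω} (hm : m ≤ mΩ)
    (hm' : m' ≤ mΩ) (hind : Indep m m' P) {Z φ : Ω → ENNReal} {A : Set Ω}
    (hZ : Measurable[m] Z) (hA : MeasurableSet[m] A) (hφ : Measurable[m'] φ)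
    (h : ∫⁻ ω, φ ω ∂P ≤ 1) :
    ∫⁻ ω, Z ω * (if ω ∈ A then φ ω else 1) ∂P ≤ ∫⁻ ω, Z ω ∂P := by
  have h1 : ∀ ω, Z ω * (if ω ∈ A then φ ω else 1) = A.indicator Z ω * φ ω + Aᶜ.indicator Z ω := by
    intro ω
    by_cases hω : ω ∈ A <;> simp [hω]
  have hZA : Measurable[m] (A.indicator Z) := hZ.indicator hA
  simp_rw [h1]
  rw [lintegral_add_right _ ((hZ.mono hm le_rfl).indicator (hm _ hA).compl),
    lintegral_mul_eq_lintegral_mul_lintegral_of_independent_measurableSpace hm hm' hind hZA hφ]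
  calc _ ≤ ∫⁻ ω, A.indicator Z ω ∂P + ∫⁻ ω, Aᶜ.indicator Z ω ∂P := by
        gcongr
        exact mul_le_of_le_one_right' h
    _ = ∫⁻ ω, A.indicator Z ω + Aᶜ.indicator Z ω ∂P :=
        (lintegral_add_left (hZA.mono hm le_rfl) _).symm
    _ = ∫⁻ ω, Z ω ∂P := by
        congr 1; ext ω
        exact Set.indicator_self_add_compl_apply A Z ω

-- Rewards are removed one at a time, latest round first. The bound `n` is separate from `u`, so
-- that induction on `n` shortens the product while the information time `u` stays fixed.
open Classical in
lemma lintegral_prod_exp_le_one [IsProbabilityMeasure P] (h : IsEnvironment P ν p r G) (c : ℝ)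
    (tie : ℕ → Fin M → Finset (Fin K) → Fin K) {k : Fin K} {f : ℝ → ENNReal} (hf : Measurable f)
    (hφ : ∀ s j, ∫⁻ ω, f (r s j k ω) ∂P ≤ 1) (i : Fin M) (u n : ℕ) :
    ∫⁻ ω, ∏ s ∈ Finset.Icc 1 n, ∏ j,
      (if coopUCB c tie (fun t i k => r t i k ω) (fun t => G t ω) s j = k ∧
        Knows (fun t => G t ω) i j u s then f (r s j k ω) else 1) ∂P ≤ 1 := by
  set F : ℕ → Fin M → Ω → ENNReal := fun s j ω =>
    if coopUCB c tie (fun t i k => r t i k ω) (fun t => G t ω) s j = k ∧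
        Knows (fun t => G t ω) i j u s then f (r s j k ω) else 1 with hF
  have hedge : ∀ (n : ℕ) (j₀ : Fin M) (s : ℕ) (i j : Fin M),
      MeasurableSet[envSigma r G {Sum.inl (n, j₀, k)}ᶜ] {ω | (G s ω).Adj i j} := fun n j₀ s i j =>
    measurableSet_adj_envSigma r G (fun e => by simp) i j
  -- Up to round `n`, actions use only rewards of rounds before `n`. All edges, including those
  -- after `n`, stay in the σ-algebra, since only one reward has been left out.
  have hset : ∀ (n : ℕ) (j₀ : Fin M) (s : ℕ) (_ : s ≤ n) (j : Fin M),
      MeasurableSet[envSigma r G {Sum.inl (n, j₀, k)}ᶜ]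
        {ω | coopUCB c tie (fun t i k => r t i k ω) (fun t => G t ω) s j = k ∧
          Knows (fun t => G t ω) i j u s} := by
    intro n j₀ s hs j
    refine MeasurableSet.inter ?_ ?_
    · refine @measurableSet_coopUCB M K Ω (envSigma r G {Sum.inl (n, j₀, k)}ᶜ) _ _ c tie s
        (fun s' hs' j' k' => measurable_reward_envSigma r G ?_) (fun s' _ i j => hedge n j₀ s' i j) j k
      simp; omega
    · exact @measurableSet_knows M Ω (envSigma r G {Sum.inl (n, j₀, k)}ᶜ) _ u s i j
        (fun x _ => hedge n j₀ x i j)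
  have hmeas : ∀ (n : ℕ) (j₀ : Fin M) (s : ℕ) (_ : s ≤ n) (j : Fin M) (_ : (s, j) ≠ (n, j₀)),
      Measurable[envSigma r G {Sum.inl (n, j₀, k)}ᶜ] (F s j) := by
    intro n j₀ s hs j hne
    refine Measurable.ite (hset n j₀ s hs j) ?_ measurable_const
    refine hf.comp (measurable_reward_envSigma r G ?_)
    simpa using hne
  induction n with
  | zero => simp
  | succ n ih =>
    refine le_trans ?_ ih
    simp_rw [Finset.prod_Icc_succ_top (show 1 ≤ n + 1 by omega)]
    -- The factors of round `n + 1` are removed agent by agent.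
    have key : ∀ W : Finset (Fin M),
        ∫⁻ ω, (∏ s ∈ Finset.Icc 1 n, ∏ j, F s j ω) * ∏ j ∈ W, F (n + 1) j ω ∂P ≤
          ∫⁻ ω, ∏ s ∈ Finset.Icc 1 n, ∏ j, F s j ω ∂P := by
      intro W
      induction W using Finset.induction_on with
      | empty => simp
      | insert j₀ W hj₀ ihW =>
        refine le_trans ?_ ihW
        simp_rw [Finset.prod_insert hj₀]
        have h1 := lintegral_mul_ite_le (P := P)
          (Z := fun ω => (∏ s ∈ Finset.Icc 1 n, ∏ j, F s j ω) * ∏ j ∈ W, F (n + 1) j ω)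
          (φ := fun ω => f (r (n + 1) j₀ k ω))
          (h.envSigma_le {Sum.inl (n + 1, j₀, k)}ᶜ) (h.envSigma_le {Sum.inl (n + 1, j₀, k)})
          (h.indep_envSigma {Sum.inl (n + 1, j₀, k)}).symm
          ?_ (hset (n + 1) j₀ (n + 1) le_rfl j₀)
          (hf.comp (measurable_reward_envSigma r G (by simp))) (hφ _ _)
        · refine le_trans (le_of_eq ?_) h1
          congr 1; ext ω
          simp only [Set.mem_ofPred_eq, hF]
          ring_nf
        · refine Measurable.mul ?_ ?_
          · refine Finset.measurable_fun_prod _ fun s hs => Finset.measurable_fun_prod _ fun j _ => ?_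
            rw [Finset.mem_Icc] at hs
            exact hmeas _ _ s (by omega) j (by simp; omega)
          · refine Finset.measurable_fun_prod _ fun j hj => ?_
            exact hmeas _ _ _ le_rfl j (by simp; rintro rfl; exact hj₀ hj)
    exact key univ

lemma lintegral_exp_knownSum_le_one [IsProbabilityMeasure P] (h : IsEnvironment P ν p r G) (c : ℝ)
    (tie : ℕ → Fin M → Finset (Fin K) → Fin K) (σ2 : ℝ≥0) (v : ℝ) (hv : σ2 ≤ v) {k : Fin K}
    (hν : HasSubgaussianMGF (fun x => x - ∫ y, y ∂(ν k)) σ2 (ν k)) (lam : ℝ) (i : Fin M) (u : ℕ) :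
    ∫⁻ ω, ENNReal.ofReal (Real.exp (lam *
        knownSum (coopUCB c tie (fun t i k => r t i k ω) (fun t => G t ω))
          (fun s j l => r s j l ω - ∫ y, y ∂(ν k)) (fun t => G t ω) i k u -
        lam ^ 2 * v / 2 * knownPulls (coopUCB c tie (fun t i k => r t i k ω) (fun t => G t ω))
          (fun t => G t ω) i k u)) ∂P ≤ 1 := by
  classical
  have hf : Measurable fun x : ℝ =>
      ENNReal.ofReal (Real.exp (lam * (x - ∫ y, y ∂(ν k)) - lam ^ 2 * v / 2)) := by fun_prop
  refine le_trans (le_of_eq ?_) (lintegral_prod_exp_le_one h c tie hf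
    (fun s j => lintegral_exp_le_one σ2 v hv h hν lam s j) i u u)
  congr 1; ext ω
  rw [knownSum_eq, knownPulls_eq, Finset.mul_sum, Finset.mul_sum, ← Finset.sum_sub_distrib,
    Real.exp_sum, ENNReal.ofReal_prod_of_nonneg fun _ _ => (Real.exp_pos _).le]
  refine Finset.prod_congr rfl fun s _ => ?_
  rw [Finset.mul_sum, Finset.mul_sum, ← Finset.sum_sub_distrib,
    Real.exp_sum, ENNReal.ofReal_prod_of_nonneg fun _ _ => (Real.exp_pos _).le]
  refine Finset.prod_congr rfl fun j _ => ?_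
  split_ifs <;> simp

end Environment

/-! ## Deviations of the estimates -/

/-- The tilt `√(c l / B) / v` is the optimal one for `N = B`. With `y = √(N / B)`, the exponent is
at least `c l / (2 v) * (2 y - y²)`, and `2 y - y² = 1 - (y - 1)² ≥ 1 - θ²`: the slice width costs
only the factor `1 - θ²`. -/
lemma le_exponent_of_deviation {c v l B N S θ : ℝ} (hc : 0 ≤ c) (hv : 0 < v) (hl : 0 ≤ l)
    (hB : 0 < B) (hθ : 0 ≤ θ) (h1 : B ≤ N) (h2 : N ≤ B * (1 + θ) ^ 2)
    (hS : √(c * l / N) < S / N) :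
    c / (2 * v) * (1 - θ ^ 2) * l ≤ √(c * l / B) / v * S - (√(c * l / B) / v) ^ 2 * v / 2 * N := by
  have hN : 0 < N := hB.trans_le h1
  have hcl : 0 ≤ c * l := mul_nonneg hc hl
  set y := √(N / B) with hy
  have hy2 : y ^ 2 = N / B := Real.sq_sqrt (by positivity)
  have hy1 : 1 ≤ y := Real.one_le_sqrt.2 ((one_le_div hB).2 h1)
  have hyθ : y ≤ 1 + θ := by
    rw [hy, Real.sqrt_le_left (by positivity), div_le_iff₀ hB]; linarith
  have hSN : √(c * l / N) * N ≤ S := by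
    rw [lt_div_iff₀ hN] at hS; exact hS.le
  have hprod : √(c * l / B) * (√(c * l / N) * N) = c * l * y := by
    have e1 : √(c * l / B) = √(c * l / N) * y := by
      rw [hy, ← Real.sqrt_mul (by positivity)]
      congr 1; field_simp
    rw [e1]
    have e2 : √(c * l / N) * √(c * l / N) = c * l / N := Real.mul_self_sqrt (by positivity)
    calc _ = (√(c * l / N) * √(c * l / N)) * N * y := by ring
      _ = c * l * y := by rw [e2]; field_simp
  have h3 : c * l * y / v ≤ √(c * l / B) / v * S := by
    rw [← hprod, div_mul_eq_mul_div]
    gcongr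
  have h4 : (√(c * l / B) / v) ^ 2 * v / 2 * N = c * l / (2 * v) * y ^ 2 := by
    rw [div_pow, Real.sq_sqrt (by positivity), hy2]; field_simp
  rw [h4]
  have h5 : 0 ≤ c * l / (2 * v) * (θ ^ 2 - (y - 1) ^ 2) :=
    mul_nonneg (by positivity) (by nlinarith)
  have h6 : c * l * y / v = c * l / (2 * v) * (2 * y) := by field_simp
  have h7 : c / (2 * v) * (1 - θ ^ 2) * l = c * l / (2 * v) * (1 - θ ^ 2) := by field_simp
  rw [h7]
  rw [h6] at h3
  nlinarith

section Deviation

variable {Ω : Type*} [MeasurableSpace Ω] {P : Measure Ω}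

lemma measureReal_le_exp_neg {Y : Ω → ℝ} (hY : Measurable Y)
    (h : ∫⁻ ω, ENNReal.ofReal (Real.exp (Y ω)) ∂P ≤ 1) (x : ℝ) :
    P.real {ω | x ≤ Y ω} ≤ Real.exp (-x) := by
  have h1 := meas_ge_le_lintegral_div (μ := P)
    (f := fun ω => ENNReal.ofReal (Real.exp (Y ω))) (by fun_prop)
    (ε := ENNReal.ofReal (Real.exp x)) (by simp [Real.exp_pos]) ENNReal.ofReal_ne_top
  have h2 : {ω | ENNReal.ofReal (Real.exp x) ≤ ENNReal.ofReal (Real.exp (Y ω))} =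
      {ω | x ≤ Y ω} := by
    ext ω
    simp only [Set.mem_ofPred_eq]
    rw [ENNReal.ofReal_le_ofReal_iff (Real.exp_pos _).le, Real.exp_le_exp]
  rw [h2] at h1
  rw [measureReal_def, Real.exp_neg]
  refine ENNReal.toReal_le_of_le_ofReal (by positivity) (h1.trans ?_)
  rw [ENNReal.ofReal_inv_of_pos (Real.exp_pos _), ← one_div]
  gcongr

/-- Deviation bound for a sum `S` of `N` centered observations, where `N` is random and ranges over
an interval `[A, A τ²]`; proved by cutting that interval into geometric slices. -/
lemma deviation_le [IsProbabilityMeasure P] {S N : Ω → ℝ} (hS : Measurable S) (hN : Measurable N) {c v θ τ A : ℝ}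
    (hc : 0 ≤ c) (hv : 0 < v) (hθ : 0 < θ) (hτ : 1 ≤ τ) (hA : 0 < A)
    (h : ∀ lam : ℝ,
      ∫⁻ ω, ENNReal.ofReal (Real.exp (lam * S ω - lam ^ 2 * v / 2 * N ω)) ∂P ≤ 1) :
    P.real {ω | A ≤ N ω ∧ N ω ≤ A * τ ^ 2 ∧ √(c * Real.log τ / N ω) < |S ω / N ω|} ≤
      2 * ((Real.log τ / Real.log (1 + θ) + 1) * τ ^ (-(c / (2 * v) * (1 - θ ^ 2)))) := by
  have hl : 0 ≤ Real.log τ := Real.log_nonneg hτ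
  have hlθ : 0 < Real.log (1 + θ) := Real.log_pos (by linarith)
  set α := c / (2 * v) * (1 - θ ^ 2) with hα
  set n := ⌊Real.log τ / Real.log (1 + θ)⌋₊ with hn
  set lam : ℕ → ℝ := fun j => √(c * Real.log τ / (A * ((1 + θ) ^ 2) ^ j)) / v with hlam
  -- Slice `j` is `A (1 + θ) ^ (2 j) ≤ N < A (1 + θ) ^ (2 (j + 1))`; the bound `N ≤ A τ²` forces `j
  -- ≤ n`. The tilts `lam j` and `-lam j` handle the two signs.
  have hsub : {ω | A ≤ N ω ∧ N ω ≤ A * τ ^ 2 ∧ √(c * Real.log τ / N ω) < |S ω / N ω|} ⊆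
      ⋃ j ∈ Finset.range (n + 1),
        ({ω | α * Real.log τ ≤ lam j * S ω - lam j ^ 2 * v / 2 * N ω} ∪
          {ω | α * Real.log τ ≤ (-lam j) * S ω - (-lam j) ^ 2 * v / 2 * N ω}) := by
    rintro ω ⟨h1, h2, h3⟩
    obtain ⟨j, hj1, hj2⟩ := exists_nat_pow_near (x := N ω / A) (y := (1 + θ) ^ 2)
      ((one_le_div hA).2 h1) (by nlinarith)
    rw [le_div_iff₀ hA] at hj1
    rw [div_lt_iff₀ hA, pow_succ] at hj2
    simp only [Set.mem_iUnion]
    refine ⟨j, ?_, ?_⟩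
    · rw [Finset.mem_range, Nat.lt_succ_iff, hn, Nat.le_floor_iff (by positivity),
        le_div_iff₀ hlθ, ← Real.log_pow]
      apply Real.log_le_log (by positivity)
      have : ((1 + θ) ^ j) ^ 2 ≤ τ ^ 2 := by
        rw [← pow_mul, mul_comm, pow_mul]
        nlinarith
      exact (pow_le_pow_iff_left₀ (by positivity) (by positivity) two_ne_zero).1 this
    · have hB : 0 < A * ((1 + θ) ^ 2) ^ j := by positivity
      rcases lt_abs.1 h3 with h4 | h4
      · left
        exact le_exponent_of_deviation hc hv hl hB hθ.le (by linarith) (by nlinarith) h4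
      · right
        rw [← neg_div] at h4
        have := le_exponent_of_deviation hc hv hl hB hθ.le (by linarith) (by nlinarith) h4
        simp only [Set.mem_ofPred_eq]
        rw [neg_sq, neg_mul, ← mul_neg]
        exact this
  refine (measureReal_mono hsub (measure_ne_top P _)).trans
    ((measureReal_biUnion_finset_le _ _).trans ?_)
  have hexp : Real.exp (-(α * Real.log τ)) = τ ^ (-α) := by
    rw [Real.rpow_def_of_pos (by linarith)]; ring_nf
  have hterm : ∀ x : ℝ, P.real {ω | α * Real.log τ ≤ x * S ω - x ^ 2 * v / 2 * N ω} ≤ τ ^ (-α) :=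
    fun x => hexp ▸ measureReal_le_exp_neg (by fun_prop) (h x) _
  calc _ ≤ ∑ _j ∈ Finset.range (n + 1), (τ ^ (-α) + τ ^ (-α)) :=
        Finset.sum_le_sum fun j _ => (measureReal_union_le _ _).trans
          (add_le_add (hterm _) (hterm _))
    _ = (n + 1) * (2 * τ ^ (-α)) := by simp; ring
    _ ≤ (Real.log τ / Real.log (1 + θ) + 1) * (2 * τ ^ (-α)) := by
        gcongr
        exact Nat.floor_le (by positivity)
    _ = _ := by ring

end Deviation

/-- The bound on the probability that an agent misjudges an arm in round `t` because of atypical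
rewards. -/
noncomputable def deviationBound (θ α : ℝ) (t : ℕ) : ℝ :=
  (Real.log t / Real.log (1 + θ) + 1) * (t : ℝ) ^ (-α)

lemma deviationBound_nonneg {θ : ℝ} (hθ : 0 < θ) (α : ℝ) (t : ℕ) : 0 ≤ deviationBound θ α t := by
  have h1 : 0 ≤ Real.log t := Real.log_natCast_nonneg t
  have h2 : 0 < Real.log (1 + θ) := Real.log_pos (by linarith)
  unfold deviationBound
  positivity

lemma summable_deviationBound {θ α : ℝ} (hθ : 0 < θ) (hα : 1 < α) :
    Summable (deviationBound θ α) := by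
  have h2 : 0 < Real.log (1 + θ) := Real.log_pos (by linarith)
  -- Half of the margin pays for the logarithm: `log t ≤ t ^ δ / δ`, and `δ - α = -(α + 1) / 2 <
  -- -1`.
  set δ := (α - 1) / 2 with hδ
  have hδ0 : 0 < δ := by rw [hδ]; linarith
  refine Summable.of_nonneg_of_le (deviationBound_nonneg hθ α) (fun t => ?_)
    (((Real.summable_nat_rpow (p := δ - α)).2 (by rw [hδ]; linarith)).mul_left
      (1 / (δ * Real.log (1 + θ))) |>.add ((Real.summable_nat_rpow (p := -α)).2 (by linarith)))
  rcases Nat.eq_zero_or_pos t with h | h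
  · subst h
    simp only [deviationBound, Nat.cast_zero, Real.log_zero, zero_div, zero_add, one_mul]
    have : (0 : ℝ) ≤ 0 ^ (δ - α) := Real.rpow_nonneg le_rfl _
    have : 0 ≤ 1 / (δ * Real.log (1 + θ)) * (0 : ℝ) ^ (δ - α) := by positivity
    linarith
  · have ht : (0 : ℝ) < t := by exact_mod_cast h
    unfold deviationBound
    rw [add_mul, one_mul]
    refine add_le_add ?_ le_rfl
    calc Real.log t / Real.log (1 + θ) * (t : ℝ) ^ (-α)
        ≤ ((t : ℝ) ^ δ / δ) / Real.log (1 + θ) * (t : ℝ) ^ (-α) := by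
          gcongr
          exact Real.log_le_rpow_div ht.le hδ0
      _ = 1 / (δ * Real.log (1 + θ)) * ((t : ℝ) ^ δ * (t : ℝ) ^ (-α)) := by field_simp
      _ = 1 / (δ * Real.log (1 + θ)) * (t : ℝ) ^ (δ - α) := by
          rw [← Real.rpow_add ht]; rfl

section Environment

variable {Ω : Type*} [MeasurableSpace Ω] {P : Measure Ω} {ν : Fin K → Measure ℝ} {p : ℝ}
  {r : ℕ → Fin M → Fin K → Ω → ℝ} {G : ℕ → Ω → SimpleGraph (Fin M)}

lemma IsEnvironment.measurableSet_coopUCB (h : IsEnvironment P ν p r G) (c : ℝ)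
    (tie : ℕ → Fin M → Finset (Fin K) → Fin K) (t : ℕ) (i : Fin M) (k : Fin K) :
    MeasurableSet {ω | coopUCB c tie (fun t i k => r t i k ω) (fun t => G t ω) t i = k} :=
  CoopBandit.measurableSet_coopUCB c tie t (fun s _ j k => h.measurable_reward s j k)
    (fun s _ i j => h.measurable_edge s i j) i k

lemma misjudges_le [IsProbabilityMeasure P] (h : IsEnvironment P ν p r G) (hp1 : p ≤ 1)
    (hM : 1 ≤ M) (hK : 1 ≤ K) {c : ℝ} (hc : 0 ≤ c)
    (tie : ℕ → Fin M → Finset (Fin K) → Fin K) (σ2 : ℝ≥0) {v : ℝ} (hv : σ2 ≤ v) (hv0 : 0 < v)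
    {k : Fin K} (hν : HasSubgaussianMGF (fun x => x - ∫ y, y ∂(ν k)) σ2 (ν k))
    {θ : ℝ} (hθ : 0 < θ) (i : Fin M) {t : ℕ} (ht : K < t) :
    P.real {ω | Misjudges c (coopUCB c tie (fun t i k => r t i k ω) (fun t => G t ω))
        (fun t i k => r t i k ω) (fun t => G t ω) (∫ y, y ∂(ν k)) i k t} ≤
      2 * deviationBound θ (c / (2 * v) * (1 - θ ^ 2)) t +
        if t < M then M * (1 - p) else 0 := by
  set a : Ω → ℕ → Fin M → Fin K :=
    fun ω => coopUCB c tie (fun t i k => r t i k ω) (fun t => G t ω) with ha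
  set N : Ω → ℝ := fun ω => knownPulls (a ω) (fun t => G t ω) i k (t - 1) with hN
  set S : Ω → ℝ := fun ω => knownSum (a ω) (fun s j l => r s j l ω - ∫ y, y ∂(ν k))
    (fun t => G t ω) i k (t - 1) with hS
  have hNm : Measurable N := measurable_knownPulls i k
    (fun s _ _ j => h.measurableSet_coopUCB c tie s j k) (fun s _ j => h.measurable_edge s i j)
  have hSm : Measurable S := measurable_knownSum
    (r := fun ω s j l => r s j l ω - ∫ y, y ∂(ν k)) i k
    (fun s _ _ j => h.measurableSet_coopUCB c tie s j k)
    (fun s _ j => (h.measurable_reward s j k).sub_const _) (fun s _ j => h.measurable_edge s i j)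
  have hN1 : ∀ ω, 1 ≤ N ω := fun ω => by
    simp only [hN, ha]
    exact_mod_cast one_le_knownPulls_coopUCB c tie _ _ (by omega : K ≤ t - 1) i k
  have ht1 : (1 : ℝ) ≤ t := by exact_mod_cast (by omega : 1 ≤ t)
  have hN2 : ∀ ω, N ω ≤ M * t := fun ω => by
    have h1 := knownPulls_le (a ω) (fun t => G t ω) i k (t - 1)
    have h2 : M * (t - 1) ≤ M * t := Nat.mul_le_mul_left M (by omega)
    simp only [hN]
    exact_mod_cast h1.trans h2
  have hdev := fun (A : ℝ) (hA : 0 < A) => deviation_le (P := P) hSm hNm hc hv0 hθ ht1 hA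
    fun lam => lintegral_exp_knownSum_le_one h c tie σ2 v hv hν lam i (t - 1)
  have hmis : ∀ ω, Misjudges c (a ω) (fun t i k => r t i k ω) (fun t => G t ω)
      (∫ y, y ∂(ν k)) i k t ↔ √(c * Real.log t / N ω) < |S ω / N ω| := by
    intro ω
    unfold Misjudges
    have hne : N ω ≠ 0 := by linarith [hN1 ω]
    have : S ω / N ω = knownMean (a ω) (fun t i k => r t i k ω) (fun t => G t ω) i k (t - 1) -
        ∫ y, y ∂(ν k) := by
      rw [knownMean_eq]
      change S ω / N ω = _ / N ω - _
      rw [hS]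
      simp only
      rw [knownSum_sub_const, sub_div]
      change _ - _ * N ω / N ω = _
      rw [mul_div_cancel_right₀ _ hne]
    rw [this]
  -- The slices start at `A = M` for `t < M`, provided `i` met everybody in round `t - 1`, and at `A
  -- = 1` otherwise. In both cases `M t ≤ A t²`, so no `log M` appears.
  split_ifs with htM
  · have hsub : {ω | Misjudges c (a ω) (fun t i k => r t i k ω) (fun t => G t ω)
        (∫ y, y ∂(ν k)) i k t} ⊆
        {ω | M ≤ N ω ∧ N ω ≤ M * (t : ℝ) ^ 2 ∧ √(c * Real.log t / N ω) < |S ω / N ω|} ∪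
          {ω | ¬ ∀ j, j ≠ i → (G (t - 1) ω).Adj i j} := by
      intro ω hω
      by_cases hadj : ∀ j, j ≠ i → (G (t - 1) ω).Adj i j
      · left
        refine ⟨?_, ?_, (hmis ω).1 hω⟩
        · simp only [hN, ha]
          exact_mod_cast card_le_knownPulls_coopUCB c tie _ (fun t => G t ω)
            (by omega : 1 ≤ t - 1) (by omega) i k hadj
        · refine (hN2 ω).trans ?_
          gcongr
          nlinarith
      · right; exact hadj
    refine (measureReal_mono hsub (measure_ne_top P _)).trans
      ((measureReal_union_le _ _).trans (add_le_add ?_ (h.not_adj_le hp1 i (t - 1))))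
    exact hdev M (by exact_mod_cast hM)
  · rw [add_zero]
    refine (measureReal_mono ?_ (measure_ne_top P _)).trans (hdev 1 one_pos)
    intro ω hω
    refine ⟨hN1 ω, ?_, (hmis ω).1 hω⟩
    have : (M : ℝ) ≤ t := by exact_mod_cast not_lt.1 htM
    nlinarith [hN2 ω]

/-- Bernoulli's inequality for `(1 + (1 / p - 1)) ^ (M ^ 2)`, together with `1 - p ≤ 1 / p - 1`. -/
lemma sq_mul_one_sub_le (hp : 0 < p) (hp1 : p ≤ 1) (M : ℕ) :
    (M : ℝ) * (M * (1 - p)) ≤ 1 / p ^ (M ^ 2) := by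
  have h1 : 1 - p ≤ 1 / p - 1 := by
    have : 1 / p - 1 - (1 - p) = (1 - p) ^ 2 / p := by field_simp
    have : 0 ≤ (1 - p) ^ 2 / p := by positivity
    linarith
  have h2 := one_add_mul_le_pow (a := 1 / p - 1) (by linarith) (M ^ 2)
  rw [add_sub_cancel, one_div_pow] at h2
  push_cast at h2
  have : (M : ℝ) ^ 2 * (1 - p) ≤ (M : ℝ) ^ 2 * (1 / p - 1) := by gcongr
  nlinarith

lemma sum_misjudges_le [IsProbabilityMeasure P] (h : IsEnvironment P ν p r G) (hp : 0 < p)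
    (hp1 : p ≤ 1) (hM : 1 ≤ M) (hK : 1 ≤ K) {c : ℝ} (hc : 0 ≤ c)
    (tie : ℕ → Fin M → Finset (Fin K) → Fin K) (σ2 : ℝ≥0) {v : ℝ} (hv : σ2 ≤ v) (hv0 : 0 < v)
    {k : Fin K} (hν : HasSubgaussianMGF (fun x => x - ∫ y, y ∂(ν k)) σ2 (ν k))
    {θ : ℝ} (hθ : 0 < θ) (hα : 1 < c / (2 * v) * (1 - θ ^ 2)) (i : Fin M) (T : ℕ) :
    ∑ t ∈ Finset.Ioc K T,
      P.real {ω | Misjudges c (coopUCB c tie (fun t i k => r t i k ω) (fun t => G t ω))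
        (fun t i k => r t i k ω) (fun t => G t ω) (∫ y, y ∂(ν k)) i k t} ≤
      (2 * ∑' t, deviationBound θ (c / (2 * v) * (1 - θ ^ 2)) t + 1) / p ^ (M ^ 2) := by
  have hb := deviationBound_nonneg hθ (c / (2 * v) * (1 - θ ^ 2))
  have h0 : 0 ≤ M * (1 - p) := mul_nonneg (by positivity) (sub_nonneg.2 hp1)
  have h1 : ∑ t ∈ Finset.Ioc K T, deviationBound θ (c / (2 * v) * (1 - θ ^ 2)) t ≤
      ∑' t, deviationBound θ (c / (2 * v) * (1 - θ ^ 2)) t :=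
    (summable_deviationBound hθ hα).sum_le_tsum _ fun t _ => hb t
  have h2 : ∑ t ∈ Finset.Ioc K T, (if t < M then M * (1 - p) else 0) ≤ M * (M * (1 - p)) := by
    rw [← Finset.sum_filter]
    calc _ ≤ ∑ t ∈ Finset.range M, M * (1 - p) :=
          Finset.sum_le_sum_of_subset_of_nonneg (fun t ht => by
            simpa using (Finset.mem_filter.1 ht).2) fun _ _ _ => h0
      _ = M * (M * (1 - p)) := by simp
  have h3 : 1 ≤ 1 / p ^ (M ^ 2) := (one_le_div (by positivity)).2 (pow_le_one₀ hp.le hp1)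
  have h4 : 0 ≤ ∑' t, deviationBound θ (c / (2 * v) * (1 - θ ^ 2)) t := tsum_nonneg hb
  calc _ ≤ ∑ t ∈ Finset.Ioc K T, (2 * deviationBound θ (c / (2 * v) * (1 - θ ^ 2)) t +
        if t < M then M * (1 - p) else 0) :=
        Finset.sum_le_sum fun t ht => misjudges_le h hp1 hM hK hc tie σ2 hv hv0 hν hθ i
          (Finset.mem_Ioc.1 ht).1
    _ ≤ 2 * ∑' t, deviationBound θ (c / (2 * v) * (1 - θ ^ 2)) t + M * (M * (1 - p)) := by
        rw [Finset.sum_add_distrib, ← Finset.mul_sum]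
        gcongr
    _ ≤ 2 * (∑' t, deviationBound θ (c / (2 * v) * (1 - θ ^ 2)) t) * (1 / p ^ (M ^ 2)) +
        1 / p ^ (M ^ 2) := by
        exact add_le_add (le_mul_of_one_le_right (by positivity) h3) (sq_mul_one_sub_le hp hp1 M)
    _ = _ := by ring

/-! ## Waiting for a complete graph -/

/-- Either the level was already pending or it is crossed in round `t + 1`; the crossing round
itself must also have an incomplete graph. -/
lemma pending_succ_subset {Ω : Type*} {G : ℕ → Ω → SimpleGraph (Fin M)} (a : Ω → ℕ → Fin M → Fin K) (k : Fin K) (L : ℝ) (t : ℕ) :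
    {ω | Pending (a ω) (fun t => G t ω) k L (t + 1)} ⊆
      ({ω | Pending (a ω) (fun t => G t ω) k L t} ∪
        ({ω | L < totalPulls (a ω) k (t + 1)} \ {ω | L < totalPulls (a ω) k t})) ∩
      {ω | AllAdj (G (t + 1) ω)}ᶜ := by
  intro ω hω
  simp only [Set.mem_ofPred_eq, pending_iff] at hω
  refine ⟨?_, hω.2 (t + 1) (by simp) hω.1⟩
  by_cases h : L < totalPulls (a ω) k t
  · left
    simp only [Set.mem_ofPred_eq, pending_iff]
    refine ⟨h, fun s hs => hω.2 s ?_⟩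
    rw [Finset.mem_Icc] at hs ⊢
    omega
  · right; exact ⟨hω.1, h⟩

lemma pending_succ_le [IsProbabilityMeasure P] (h : IsEnvironment P ν p r G) (hp : 0 < p)
    (hp1 : p ≤ 1) (c : ℝ) (tie : ℕ → Fin M → Finset (Fin K) → Fin K) (k : Fin K) (L : ℝ) (t : ℕ) :
    P.real {ω | Pending (coopUCB c tie (fun t i k => r t i k ω) (fun t => G t ω))
        (fun t => G t ω) k L (t + 1)} ≤
      (P.real {ω | Pending (coopUCB c tie (fun t i k => r t i k ω) (fun t => G t ω))
        (fun t => G t ω) k L t} +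
      (P.real {ω | L < totalPulls (coopUCB c tie (fun t i k => r t i k ω) (fun t => G t ω))
        k (t + 1)} -
      P.real {ω | L < totalPulls (coopUCB c tie (fun t i k => r t i k ω) (fun t => G t ω)) k t}))
        * (1 - p ^ (M ^ 2)) := by
  set a : Ω → ℕ → Fin M → Fin K :=
    fun ω => coopUCB c tie (fun t i k => r t i k ω) (fun t => G t ω) with ha
  -- All variables except the edges of round `t + 1`. The actions of round `t + 1` are still
  -- measurable, because that graph is used only after the pulls.
  set S : Set (EnvIndex M K) := {x | ∀ e, x ≠ Sum.inr (t + 1, e)} with hS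
  have hr : ∀ s j l, Measurable[envSigma r G S] (r s j l) := fun s j l =>
    measurable_reward_envSigma r G (by simp [hS])
  have hG : ∀ s ≤ t, ∀ i j, MeasurableSet[envSigma r G S] {ω | (G s ω).Adj i j} := fun s hs i j =>
    measurableSet_adj_envSigma r G (fun e => by simp [hS]; omega) i j
  have hact : ∀ s ≤ t + 1, ∀ i, MeasurableSet[envSigma r G S] {ω | a ω s i = k} := fun s hs i =>
    @measurableSet_coopUCB M K Ω (envSigma r G S) _ _ c tie s (fun s' _ j l => hr s' j l)
      (fun s' hs' i j => hG s' (by omega) i j) i k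
  have hlev : ∀ s ≤ t + 1, MeasurableSet[envSigma r G S] {ω | L < (totalPulls (a ω) k s : ℝ)} :=
    fun s hs => @measurable_totalPulls M K Ω (envSigma r G S) a k s
      (fun s' _ h2 i => hact s' (h2.trans hs) i) _ measurableSet_Ioi
  have hpend : MeasurableSet[envSigma r G S] {ω | Pending (a ω) (fun t => G t ω) k L t} :=
    @measurableSet_pending M K Ω (envSigma r G S) a _ k L t
      (fun s _ h2 i => hact s (by omega) i) hG
  have hcomp : MeasurableSet[envSigma r G Sᶜ] {ω | AllAdj (G (t + 1) ω)} :=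
    @measurableSet_allAdj M Ω (envSigma r G Sᶜ) (fun ω t => G t ω) (t + 1)
      fun i j => measurableSet_adj_envSigma r G (fun e hm => hm e rfl) i j
  have hind := (Indep_iff _ _ _).1 (h.indep_envSigma S) _ _
    (hpend.union ((hlev (t + 1) le_rfl).diff (hlev t (by omega)))) hcomp.compl
  have hle := h.envSigma_le S
  refine (measureReal_mono (pending_succ_subset a k L t) (measure_ne_top P _)).trans ?_
  rw [measureReal_def, hind, ENNReal.toReal_mul, ← measureReal_def, ← measureReal_def]
  refine mul_le_mul ?_ ?_ measureReal_nonneg ?_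
  · refine (measureReal_union_le _ _).trans (add_le_add le_rfl (le_of_eq ?_))
    refine measureReal_sdiff ?_ (hle _ (hlev t (by omega)))
    intro ω hω
    have : (totalPulls (a ω) k t : ℝ) ≤ totalPulls (a ω) k (t + 1) := by
      exact_mod_cast totalPulls_mono (a ω) k (by omega)
    exact lt_of_lt_of_le hω this
  · rw [probReal_compl_eq_one_sub (h.envSigma_le Sᶜ _ hcomp)]
    linarith [h.pow_le_allAdj hp hp1 (t + 1)]
  · refine add_nonneg measureReal_nonneg (sub_nonneg.2 (measureReal_mono ?_ (measure_ne_top P _)))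
    intro ω hω
    have : (totalPulls (a ω) k t : ℝ) ≤ totalPulls (a ω) k (t + 1) := by
      exact_mod_cast totalPulls_mono (a ω) k (by omega)
    exact lt_of_lt_of_le hω this

lemma sum_pending_le [IsProbabilityMeasure P] (h : IsEnvironment P ν p r G) (hp : 0 < p)
    (hp1 : p ≤ 1) (c : ℝ) (tie : ℕ → Fin M → Finset (Fin K) → Fin K) (k : Fin K) {L : ℝ}
    (hL : 0 ≤ L) (T : ℕ) :
    ∑ t ∈ Finset.range T,
      P.real {ω | Pending (coopUCB c tie (fun t i k => r t i k ω) (fun t => G t ω))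
        (fun t => G t ω) k L t} ≤ 1 / p ^ (M ^ 2) := by
  set x : ℕ → ℝ := fun t => P.real {ω | Pending
    (coopUCB c tie (fun t i k => r t i k ω) (fun t => G t ω)) (fun t => G t ω) k L t} with hx
  set y : ℕ → ℝ := fun t => P.real {ω | L <
    totalPulls (coopUCB c tie (fun t i k => r t i k ω) (fun t => G t ω)) k t} with hy
  set q := p ^ (M ^ 2) with hq
  have hq0 : 0 < q := by positivity
  have hq1 : q ≤ 1 := pow_le_one₀ hp.le hp1
  have hstep : ∀ t, x (t + 1) ≤ (x t + (y (t + 1) - y t)) * (1 - q) :=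
    fun t => pending_succ_le h hp hp1 c tie k L t
  have hx0 : x 0 = 0 := by
    simp [hx, Pending, totalPulls_zero, hL.not_gt]
  have hxn : ∀ t, 0 ≤ x t := fun t => measureReal_nonneg
  have hy0 : 0 ≤ y 0 := measureReal_nonneg
  -- The crossing probabilities telescope to at most 1, so the sum `X` of the pending probabilities
  -- satisfies `X ≤ (X + 1) (1 - q)`, whence `q X ≤ 1`.
  have key : ∀ T, ∑ t ∈ Finset.range (T + 1), x t ≤
      (∑ t ∈ Finset.range T, x t + (y T - y 0)) * (1 - q) := by
    intro T
    induction T with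
    | zero => simp [hx0]
    | succ T ih =>
      have e := Finset.sum_range_succ x T
      rw [Finset.sum_range_succ x (T + 1)]
      rw [e] at ih ⊢
      linarith [hstep T]
  have h1 := key T
  have h2 : y T ≤ 1 := measureReal_le_one
  rw [Finset.sum_range_succ] at h1
  rw [le_div_iff₀ hq0]
  nlinarith [hxn T, mul_nonneg hy0 (sub_nonneg.2 hq1),
    mul_nonneg (sub_nonneg.2 h2) (sub_nonneg.2 hq1)]

end Environment

/-! ## Expected regret -/

section Regret

variable {Ω : Type*} [MeasurableSpace Ω] {P : Measure Ω} {ν : Fin K → Measure ℝ} {p : ℝ}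
  {r : ℕ → Fin M → Fin K → Ω → ℝ} {G : ℕ → Ω → SimpleGraph (Fin M)}

lemma IsEnvironment.integrable_totalPulls [IsProbabilityMeasure P] (h : IsEnvironment P ν p r G)
    (c : ℝ) (tie : ℕ → Fin M → Finset (Fin K) → Fin K) (k : Fin K) (T : ℕ) :
    Integrable (fun ω => (totalPulls
      (coopUCB c tie (fun t i k => r t i k ω) (fun t => G t ω)) k T : ℝ)) P := by
  refine Integrable.of_bound (C := M * T) (measurable_totalPulls k T
    fun s _ _ i => h.measurableSet_coopUCB c tie s i k).aestronglyMeasurable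
    (Filter.Eventually.of_forall fun ω => ?_)
  rw [Real.norm_of_nonneg (by positivity), totalPulls]
  have : ∑ i, pulls (coopUCB c tie (fun t i k => r t i k ω) (fun t => G t ω)) i k T ≤ M * T := by
    calc _ ≤ ∑ _i : Fin M, T := Finset.sum_le_sum fun i _ => pulls_le _ i k T
      _ = M * T := by simp
  exact_mod_cast this

lemma regret_eq (Δ : Fin K → ℝ) (a : ℕ → Fin M → Fin K) (T : ℕ) :
    regret Δ a T = ∑ k, Δ k / M * totalPulls a k T := by
  unfold regret totalPulls
  rw [Finset.mul_sum]
  refine Finset.sum_congr rfl fun k _ => ?_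
  rw [← Finset.mul_sum]
  push_cast
  ring

lemma integral_totalPulls_le [IsProbabilityMeasure P] (h : IsEnvironment P ν p r G) (hp : 0 < p)
    (hp1 : p ≤ 1) (hM : 1 ≤ M) (hK : 1 ≤ K) {c : ℝ} (hc : 0 ≤ c)
    {tie : ℕ → Fin M → Finset (Fin K) → Fin K} (htie : IsTieRule tie) (σ2 : ℝ≥0) {v : ℝ}
    (hv : σ2 ≤ v) (hv0 : 0 < v)
    (hν : ∀ k, HasSubgaussianMGF (fun x => x - ∫ y, y ∂(ν k)) σ2 (ν k))
    {θ : ℝ} (hθ : 0 < θ) (hα : 1 < c / (2 * v) * (1 - θ ^ 2)) {k l : Fin K}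
    (hgap : 0 < gap ν l k) (T : ℕ) :
    ∫ ω, (totalPulls (coopUCB c tie (fun t i k => r t i k ω) (fun t => G t ω)) k T : ℝ) ∂P ≤
      4 * c * Real.log T / gap ν l k ^ 2 + M * (
        (4 * ∑' t, deviationBound θ (c / (2 * v) * (1 - θ ^ 2)) t + 5) / p ^ (M ^ 2)) := by
  classical
  set a : Ω → ℕ → Fin M → Fin K :=
    fun ω => coopUCB c tie (fun t i k => r t i k ω) (fun t => G t ω) with ha
  set L := 4 * c * Real.log T / gap ν l k ^ 2 with hL
  set B := ∑' t, deviationBound θ (c / (2 * v) * (1 - θ ^ 2)) t with hB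
  set q := p ^ (M ^ 2) with hq
  have hL0 : 0 ≤ L := by
    have : 0 ≤ Real.log T := Real.log_natCast_nonneg T
    positivity
  have hq0 : 0 < q := by positivity
  have hq1 : 1 ≤ 1 / q := (one_le_div hq0).2 (pow_le_one₀ hp.le hp1)
  have hact : ∀ (l : Fin K) s i, MeasurableSet {ω | a ω s i = l} := fun l s i =>
    h.measurableSet_coopUCB c tie s i l
  have hVm : ∀ s, MeasurableSet {ω | Pending (a ω) (fun t => G t ω) k L s} := fun s =>
    measurableSet_pending k L s (fun s _ _ i => hact k s i) fun s _ i j => h.measurable_edge s i j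
  have hBm : ∀ (l : Fin K) i t, MeasurableSet {ω | Misjudges c (a ω) (fun t i k => r t i k ω)
      (fun t => G t ω) (∫ y, y ∂(ν l)) i l t} := fun l i t =>
    measurableSet_misjudges c _ i l t (fun s j => hact l s j)
      (fun s j => h.measurable_reward s j l) fun s j => h.measurable_edge s i j
  have hint : ∀ {A : Set Ω}, MeasurableSet A →
      Integrable (fun ω => if ω ∈ A then (1 : ℝ) else 0) P := fun {A} hA =>
    (integrable_indicator_iff hA).2 (integrable_const (1 : ℝ)).integrableOn
  have heval : ∀ {A : Set Ω}, MeasurableSet A →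
      ∫ ω, (if ω ∈ A then (1 : ℝ) else 0) ∂P = P.real A := fun {A} hA =>
    integral_indicator_one hA
  set U : Ω → ℝ := fun ω => M * ∑ s ∈ Finset.range T,
    (if ω ∈ {ω | Pending (a ω) (fun t => G t ω) k L s} then (1 : ℝ) else 0) with hU
  set W : Fin M → ℕ → Ω → ℝ := fun i s ω =>
    (if ω ∈ {ω | Misjudges c (a ω) (fun t i k => r t i k ω)
      (fun t => G t ω) (∫ y, y ∂(ν k)) i k s} then (1 : ℝ) else 0) +
    if ω ∈ {ω | Misjudges c (a ω) (fun t i k => r t i k ω)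
      (fun t => G t ω) (∫ y, y ∂(ν l)) i l s} then (1 : ℝ) else 0 with hW
  have hpt : ∀ ω, (totalPulls (a ω) k T : ℝ) ≤
      (L + 2 * M) + (U ω + ∑ s ∈ Finset.Ioc K T, ∑ i, W i s ω) := by
    intro ω
    have h1 : (totalPulls (a ω) k T : ℝ) ≤ (if T ≤ (k : ℕ) then 0 else (M : ℝ)) +
        min (totalPulls (a ω) k T : ℝ) (L + M) + U ω + ∑ s ∈ Finset.Ioc K T, ∑ i, W i s ω :=
      totalPulls_coopUCB_le c tie (fun t i k => r t i k ω) (fun t => G t ω) hK htie hc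
        (k := k) (l := l) (m := ∫ y, y ∂(ν k)) (m' := ∫ y, y ∂(ν l)) (sub_pos.1 hgap) T T le_rfl
    have h2 : (if T ≤ (k : ℕ) then (0 : ℝ) else M) ≤ M := by split_ifs <;> simp
    have h3 := min_le_right (totalPulls (a ω) k T : ℝ) (L + M)
    linarith
  have hI1 : Integrable U P := (integrable_finsetSum _ fun s _ => hint (hVm s)).const_mul _
  have hI2 : ∀ i s, Integrable (W i s) P := fun i s => (hint (hBm k i s)).add (hint (hBm l i s))
  have hI3 : Integrable (fun ω => ∑ s ∈ Finset.Ioc K T, ∑ i, W i s ω) P :=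
    integrable_finsetSum _ fun s _ => integrable_finsetSum _ fun i _ => hI2 i s
  have hEU : ∫ ω, U ω ∂P = M * ∑ s ∈ Finset.range T,
      P.real {ω | Pending (a ω) (fun t => G t ω) k L s} := by
    rw [hU, integral_const_mul, integral_finsetSum _ fun s _ => hint (hVm s)]
    simp_rw [heval (hVm _)]
  have hEW : ∀ i s, ∫ ω, W i s ω ∂P =
      P.real {ω | Misjudges c (a ω) (fun t i k => r t i k ω)
        (fun t => G t ω) (∫ y, y ∂(ν k)) i k s} +
      P.real {ω | Misjudges c (a ω) (fun t i k => r t i k ω)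
        (fun t => G t ω) (∫ y, y ∂(ν l)) i l s} := fun i s => by
    rw [hW, integral_add (hint (hBm k i s)) (hint (hBm l i s)), heval (hBm k i s),
      heval (hBm l i s)]
  have hIUW : Integrable (fun ω => U ω + ∑ s ∈ Finset.Ioc K T, ∑ i, W i s ω) P := hI1.add hI3
  refine (integral_mono (h.integrable_totalPulls c tie k T)
    ((integrable_const _).add hIUW) hpt).trans ?_
  simp only [Pi.add_apply]
  rw [integral_add (integrable_const _) hIUW, integral_add hI1 hI3, hEU,
    integral_finsetSum _ fun s _ => integrable_finsetSum _ fun i _ => hI2 i s]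
  simp_rw [integral_finsetSum _ fun i _ => hI2 i _, hEW]
  have hS1 := sum_pending_le h hp hp1 c tie k hL0 T
  have hS2 : ∀ l, ∑ s ∈ Finset.Ioc K T, ∑ i, P.real {ω | Misjudges c (a ω)
      (fun t i k => r t i k ω) (fun t => G t ω) (∫ y, y ∂(ν l)) i l s} ≤
      M * ((2 * B + 1) / q) := by
    intro l
    rw [Finset.sum_comm]
    calc _ ≤ ∑ _i : Fin M, ((2 * B + 1) / q) := Finset.sum_le_sum fun i _ =>
          sum_misjudges_le h hp hp1 hM hK hc tie σ2 hv hv0 (hν l) hθ hα i T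
      _ = _ := by simp
  simp only [Finset.sum_add_distrib, integral_const, probReal_univ, one_smul]
  have hM0 : (0 : ℝ) ≤ M := by positivity
  have h5 := mul_le_mul_of_nonneg_left hS1 hM0
  have h6 := mul_le_mul_of_nonneg_left hq1 hM0
  -- The 5 collects 1 from the misjudgements of each of the two arms, 1 from pending rounds, and 2
  -- from the initial pulls and the overshoot, absorbed by `1 ≤ 1 / q`.
  have h7 : (M : ℝ) * ((4 * B + 5) / q) =
      2 * (M * ((2 * B + 1) / q)) + 3 * (M * (1 / q)) := by ring
  rw [h7]
  linarith [hS2 k, hS2 l]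

lemma integral_ucbRegret_le [IsProbabilityMeasure P] (h : IsEnvironment P ν p r G) (hp : 0 < p)
    (hp1 : p ≤ 1) (hM : 1 ≤ M) (hK : 1 ≤ K) {c : ℝ} (hc : 0 ≤ c)
    {tie : ℕ → Fin M → Finset (Fin K) → Fin K} (htie : IsTieRule tie) (σ2 : ℝ≥0) {v : ℝ}
    (hv : σ2 ≤ v) (hv0 : 0 < v)
    (hν : ∀ k, HasSubgaussianMGF (fun x => x - ∫ y, y ∂(ν k)) σ2 (ν k))
    {θ : ℝ} (hθ : 0 < θ) (hα : 1 < c / (2 * v) * (1 - θ ^ 2)) {kstar : Fin K}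
    (hkstar : ∀ k, 0 ≤ gap ν kstar k) {D : ℝ} (hD : ∀ k, gap ν kstar k ≤ D) (T : ℕ) :
    Integrable (ucbRegret c tie (gap ν kstar) r G T) P ∧
      ∫ ω, ucbRegret c tie (gap ν kstar) r G T ω ∂P ≤
        4 * c * (∑ k with 0 < gap ν kstar k, Real.log T / (M * gap ν kstar k)) +
        D * (4 * ∑' t, deviationBound θ (c / (2 * v) * (1 - θ ^ 2)) t + 5) *
          (K / p ^ (M ^ 2)) := by
  have hint := fun k => (h.integrable_totalPulls c tie k T).const_mul (gap ν kstar k / M)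
  have heq : ucbRegret c tie (gap ν kstar) r G T = fun ω => ∑ k, gap ν kstar k / M *
      totalPulls (coopUCB c tie (fun t i k => r t i k ω) (fun t => G t ω)) k T := by
    funext ω
    rw [ucbRegret, regret_eq]
  rw [heq]
  refine ⟨integrable_finsetSum _ fun k _ => hint k, ?_⟩
  rw [integral_finsetSum _ fun k _ => hint k]
  simp_rw [integral_const_mul]
  set E := (4 * ∑' t, deviationBound θ (c / (2 * v) * (1 - θ ^ 2)) t + 5) / p ^ (M ^ 2) with hE
  have hE0 : 0 ≤ E := by
    have : 0 ≤ ∑' t, deviationBound θ (c / (2 * v) * (1 - θ ^ 2)) t := tsum_nonneg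
      (deviationBound_nonneg hθ (c / (2 * v) * (1 - θ ^ 2)))
    positivity
  have hM0 : (0 : ℝ) < M := by exact_mod_cast hM
  have hD0 : 0 ≤ D := (hkstar kstar).trans (hD kstar)
  have hterm : ∀ k, gap ν kstar k / M *
      ∫ ω, (totalPulls (coopUCB c tie (fun t i k => r t i k ω) (fun t => G t ω)) k T : ℝ) ∂P ≤
      (if 0 < gap ν kstar k then 4 * c * (Real.log T / (M * gap ν kstar k)) else 0) + D * E := by
    intro k
    rcases (hkstar k).eq_or_lt with h0 | h0
    · rw [← h0, zero_div, zero_mul, if_neg (lt_irrefl _)]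
      positivity
    · rw [if_pos h0]
      calc _ ≤ gap ν kstar k / M * (4 * c * Real.log T / gap ν kstar k ^ 2 + M * E) := by
            gcongr
            exact integral_totalPulls_le h hp hp1 hM hK hc htie σ2 hv hv0 hν hθ hα h0 T
        _ = 4 * c * (Real.log T / (M * gap ν kstar k)) + gap ν kstar k * E := by
            field_simp
        _ ≤ _ := by
            gcongr
            exact hD k
  refine (Finset.sum_le_sum fun k _ => hterm k).trans (le_of_eq ?_)
  rw [Finset.sum_add_distrib, ← Finset.sum_filter, ← Finset.mul_sum]
  simp only [Finset.sum_const, Finset.card_univ, Fintype.card_fin, nsmul_eq_mul, hE]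
  ring

end Regret

end CoopBandit

theorem theorem1 (σ2 : ℝ≥0) (c D : ℝ) (hc : 2 * (σ2 : ℝ) < c) :
    ∃ C : ℝ, ∀ (M K : ℕ) (_hM : 1 ≤ M) (_hK : 1 ≤ K)
      (ν : Fin K → Measure ℝ)
      (_hν : ∀ k, HasSubgaussianMGF (fun x => x - ∫ y, y ∂(ν k)) σ2 (ν k))
      (kstar : Fin K) (_hkstar : ∀ k, 0 ≤ CoopBandit.gap ν kstar k)
      (_hD : ∀ k, CoopBandit.gap ν kstar k ≤ D)
      (p : ℝ) (_hp : 0 < p) (_hp1 : p ≤ 1)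
      (tie : ℕ → Fin M → Finset (Fin K) → Fin K) (_htie : CoopBandit.IsTieRule tie)
      {Ω : Type*} [MeasurableSpace Ω] (P : Measure Ω) [IsProbabilityMeasure P]
      (r : ℕ → Fin M → Fin K → Ω → ℝ) (G : ℕ → Ω → SimpleGraph (Fin M))
      (_henv : CoopBandit.IsEnvironment P ν p r G)
      (T : ℕ) (_hT : 1 ≤ T),
      Integrable (CoopBandit.ucbRegret c tie (CoopBandit.gap ν kstar) r G T) P ∧
        ∫ ω, CoopBandit.ucbRegret c tie (CoopBandit.gap ν kstar) r G T ω ∂P ≤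
          C * ((∑ k with 0 < CoopBandit.gap ν kstar k,
              Real.log T / (M * CoopBandit.gap ν kstar k)) + K / p ^ (M ^ 2)) := by
  have hσ : (0 : ℝ) ≤ σ2 := σ2.2
  -- The midpoint of `σ2` and `c / 2`: positive even for `σ2 = 0`, and still with `c / (2 v) > 1`.
  set v : ℝ := (σ2 + c / 2) / 2 with hv
  have hv0 : 0 < v := by rw [hv]; linarith
  have hσv : (σ2 : ℝ) ≤ v := by rw [hv]; linarith
  have hβ : 1 < c / (2 * v) := by
    rw [one_lt_div (by positivity), hv]; linarith
  obtain ⟨θ, hθ, hα⟩ : ∃ θ : ℝ, 0 < θ ∧ 1 < c / (2 * v) * (1 - θ ^ 2) := by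
    have h1 : 0 < (1 - 1 / (c / (2 * v))) / 2 := by
      have : 1 / (c / (2 * v)) < 1 := (div_lt_one (by linarith)).2 hβ
      linarith
    -- With `β = c / (2 v)`, this makes `β (1 - θ²)` the midpoint `(β + 1) / 2` of 1 and `β`.
    refine ⟨√((1 - 1 / (c / (2 * v))) / 2), Real.sqrt_pos.2 h1, ?_⟩
    rw [Real.sq_sqrt h1.le]
    have : c / (2 * v) * (1 - (1 - 1 / (c / (2 * v))) / 2) = (c / (2 * v) + 1) / 2 := by
      generalize c / (2 * v) = β at hβ
      have : β ≠ 0 := by linarith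
      field_simp
      ring
    rw [this]; linarith
  set E := 4 * ∑' t, CoopBandit.deviationBound θ (c / (2 * v) * (1 - θ ^ 2)) t + 5 with hE
  have hE0 : 0 ≤ E := by
    have : 0 ≤ ∑' t, CoopBandit.deviationBound θ (c / (2 * v) * (1 - θ ^ 2)) t := tsum_nonneg
      (CoopBandit.deviationBound_nonneg hθ (c / (2 * v) * (1 - θ ^ 2)))
    positivity
  -- The constant is chosen before it is known that `D ≥ 0`, hence the absolute value.
  refine ⟨4 * c + |D| * E, ?_⟩
  intro M K hM hK ν hν kstar hkstar hD p hp hp1 tie htie Ω _ P _ r G henv T hT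
  obtain ⟨h1, h2⟩ := CoopBandit.integral_ucbRegret_le henv hp hp1 hM hK (by linarith : 0 ≤ c) htie
    σ2 hσv hv0 hν hθ hα hkstar hD T
  refine ⟨h1, h2.trans ?_⟩
  have hX : 0 ≤ ∑ k with 0 < CoopBandit.gap ν kstar k,
      Real.log T / (M * CoopBandit.gap ν kstar k) :=
    Finset.sum_nonneg fun k _ => div_nonneg (Real.log_natCast_nonneg T)
      (mul_nonneg (by positivity) (hkstar k))
  have hY : (0 : ℝ) ≤ K / p ^ (M ^ 2) := by positivity
  have hDE : 0 ≤ |D| * E := by positivity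
  have h3 : D * E * (K / p ^ (M ^ 2)) ≤ |D| * E * (K / p ^ (M ^ 2)) := by
    gcongr
    exact le_abs_self D
  have h4 : 0 ≤ 4 * c * (K / p ^ (M ^ 2)) := mul_nonneg (by linarith) hY
  have h5 := mul_nonneg hDE hX
  rw [add_mul, mul_add, mul_add]
  linarith
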